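/- **Setting.** Let $\mathcal V$ be a braided rigid monoidal category with braiding $\sigma$ which admits a coend $C=\int^{X}{}^\vee X\otimes X$, with universal dinatural transformation $\iota_X:{}^\vee X\otimes X\to C$ (here $\mathrm{ev}:{}^\vee X\otimes X\to\mathbb 1$, $\mathrm{coev}:\mathbb 1\to X\otimes{}^\vee X$) and universal coaction $\delta_X=(X\otimes\iota_X)(\mathrm{coev}_X\otimes X):X\to X\otimes C$. For every $D$, $f\mapsto (X\otimes f)\delta_X$ is a bijection from $\mathrm{Hom}(C,D)$ to natural families $X\to X\otimes D$, and $f\mapsto (X\otimes Y\otimes f)\gamma_{X,Y}$, with $\gamma_{X,Y}=(X\otimes\sigma_{C,Y}\otimes C)(\delta_X\otimes\delta_Y)$, is a bijection from $\mathrm{Hom}(C\otimes C,D)$ to natural families $X\otimes Y\to X\otimes Y\otimes D$. Through these bijections one defines: $\Delta_C$ from $(\delta_X\otimes C)\delta_X$; $\epsilon_C$ from $\mathrm{id}_X$; $u_C=\delta_{\mathbb 1}$; $m_C$ from $\delta_{X\otimes Y}$; the pairings $\omega,\underline\omega:C\otimes C\to\mathbb 1$ from the inverse double braiding $\sigma_{X,Y}^{-1}\sigma_{Y,X}^{-1}$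 and from the double braiding $\sigma_{Y,X}\sigma_{X,Y}$; and $S_C$ from $X\to X\otimes X^\vee\otimes X\to X\otimes X^\vee\otimes C\otimes X\to C\otimes X\to X\otimes C$, where the maps are coevaluation ($\mathbb 1\to X^\vee\otimes X$), $\delta_{X^\vee}$, evaluation ($X\otimes X^\vee\to\mathbb 1$) and $\sigma_{X,C}^{-1}$. Let $H$ be a bialgebra in $\mathcal V$ with product $\mu$, unit $\eta$, coproduct $\Delta$ and counit $\epsilon$, and let $\mathcal V_H$ be the monoidal category of right $H$-modules $(M,r_M)$ with diagonal action on tensor products. For a morphism $\mathfrak R:C\otimes C\to H\otimes H$ and modules $M,N$ put $$\sigma^{\mathfrak R}_{M,N}=(r_N\otimes r_M)(\sigma_{M,N\otimes H}\otimes H)(M\otimes N\otimes\mathfrak R)\gamma_{M,N}:M\otimes N\to N\otimes M .$$ **Graphical formulas.** Morphisms below are read on strands, as lists of operations applied from top to bottom; $\bullet$ separates the steps, "$x$ over $y_1\dots y_k$" means that the strand (or block) $x$ is moved to the right of the adjacent block $y_1\dots y_k$ by the positive braiding $\sigma$, and a pairing or product is applied to adjacent strands. Put $\Delta_{C\otimes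 C}=(C\otimes\sigma\otimes C)(\Delta_C\otimes\Delta_C)$ and $\mu_{H\otimes H}=(\mu\otimes\mu)(H\otimes\sigma\otimes H)$. * $E:C\otimes C\to C\otimes C$: $\Delta_C\otimes\Delta_C$ gives $c_1c_2a_1a_2$ $\bullet$ $c_1c_2$ over $a_1$ $\bullet$ $c_2$ over $a_2$, giving $a_1c_1a_2c_2$ $\bullet$ $\underline\omega(c_1,a_2)$. * $G=(C\otimes\omega\otimes C)(\delta_C\otimes\Delta_C):C\otimes C\to C\otimes C$. $\mathfrak R$ is an *$R$-matrix* if * (R1) on $C\otimes C\otimes H$: $\mu_{H\otimes H}(\mathfrak R\otimes\Delta)$ equals the morphism: $cyh\mapsto c\,y\,h'\,h''$ ($\Delta$) $\bullet$ $\delta_H$ on $h'$ and on $h''$: $c\,y\,h'\,z\,h''\,q$ $\bullet$ $cy$ over $h'$ $\bullet$ $E(y,z)=(p,a)$: $h'\,c\,p\,a\,h''\,q$ $\bullet$ $cpa$ over $h''$ $\bullet$ $m_C(c,p)$, $m_C(a,q)$ $\bullet$ $\mathfrak R$: $h'\,h''\,H_1\,H_2$ $\bullet$ $h'$ over $h''H_1$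 $\bullet$ $\mu\otimes\mu$; * (R2) on $C\otimes C\otimes C$: $(H\otimes\Delta)\mathfrak R(m_C\otimes C)$ equals: $\delta_C\otimes\Delta_C\otimes\Delta_C$: $c_0\,c'\,b_1\,b_2\,z_1\,z_2$ $\bullet$ $\omega(c',b_1)$ $\bullet$ $b_2$ over $z_1$ $\bullet$ $\mathfrak R(b_2,z_2)$: $c_0\,z_1\,H_1\,H_2$ $\bullet$ $\delta_H$ on $H_1$: $c_0\,z_1\,H_1\,d\,H_2$ $\bullet$ $c_0z_1$ over $H_1$ $\bullet$ $m_C(z_1,d)$ $\bullet$ $\mathfrak R$: $H_1\,H_3\,H_4\,H_2$ $\bullet$ $\mu(H_1,H_3)$; * (R3) on $C\otimes C\otimes C$: $(\Delta\otimes H)\mathfrak R(C\otimes m_C)$ equals: $c\,b\,z\mapsto c_1\,c_2\,b\,z$ ($\Delta_C$) $\bullet$ $\mathfrak R(c_2,b)$: $c_1\,H_1\,H_2\,z$ $\bullet$ $c_1$ over $H_1$ $\bullet$ $\delta_H$ on $H_2$: $H_1\,c_1\,H_2\,p\,z$ $\bullet$ $c_1$ over $H_2$ $\bullet$ $m_C(c_1,p)=c$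 $\bullet$ $\delta_H$ on $H_1$, $\Delta_C$ on $z$: $H_1\,q\,H_2\,c\,z_1\,z_2$ $\bullet$ $H_2c$ over $z_1$ $\bullet$ $\omega(q,z_1)$ $\bullet$ $\mathfrak R(c,z_2)$: $H_1\,H_2\,H_3\,H_4$ $\bullet$ $H_2$ over $H_3$ $\bullet$ $\mu(H_2,H_4)$; * (R4) $(\epsilon\otimes H)\mathfrak R(C\otimes u_C)=\eta\epsilon_C=(H\otimes\epsilon)\mathfrak R(u_C\otimes C)$. Then $\sigma^{\mathfrak R}$ is the lax braiding of $\mathcal V_H$ defined by $\mathfrak R$. Let $Q:C\otimes C\to H\otimes H$ be the morphism $\Delta_{C\otimes C}$ $\bullet$ $\mathfrak R$ on the last two strands: $c\,a\,H_1\,H_2$ $\bullet$ $\delta_H\otimes\delta_H$: $c\,a\,H_1\,x\,H_2\,y$ $\bullet$ $ca$ over $H_1$ $\bullet$ $m_C(a,x)=a'$ $\bullet$ $E(c,a')$: $H_1\,p\,q\,H_2\,y$ $\bullet$ $pq$ over $H_2$ $\bullet$ $m_C(q,y)$ $\bullet$ $\mathfrak R$: $H_1\,H_2\,H_3\,H_4$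 $\bullet$ $H_1$ over $H_2H_3$ $\bullet$ $\mu\otimes\mu$ (it represents $\sigma^{\mathfrak R}_{N,M}\sigma^{\mathfrak R}_{M,N}$ and generalizes $R_{21}R$). A morphism $\mathfrak t:C\to H$ is a *$C$-balanced element* of $(H,\mathfrak R)$ if * (CT1) $\mathfrak t$ is central: $\mu(\mathfrak t\otimes H)=\mu(H\otimes\mathfrak t m_C)(\sigma_{C,H}\otimes C)(C\otimes\delta_H)$; * (CT2) $\epsilon\,\mathfrak t\,u_C=\mathrm{id}_{\mathbb 1}$; * (CT3) $\Delta\,\mathfrak t\,m_C=\mu_{H\otimes H}\bigl((\mathfrak t\otimes\mathfrak t)G\otimes Q\bigr)\Delta_{C\otimes C}$. If $H$ is a Hopf algebra (with invertible antipode $S_H$), $\mathfrak t$ is *$C$-ribbon* if moreover (CT4) $S(\mathfrak t)=\mathfrak t$. Here $S(\mathfrak a)$, for $\mathfrak a:C\to H$, is: $c\,H^\vee H$ (coevaluation $\mathbb 1\to H^\vee\otimes H$) $\bullet$ $\delta_H$: $c\,H^\vee H\,e$ $\bullet$ $c$ over $H^\vee H$ $\bullet$ $S_C m_C(c,e)=d$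 $\bullet$ $H^\vee H$ over $d$ $\bullet$ $S_H\mathfrak a$ on $d$ $\bullet$ evaluation $H\otimes H^\vee\to\mathbb 1$, leaving $H$. A *balanced structure* on $\mathcal V_H$ is a natural endomorphism $\theta$ of the identity functor with $\theta_{M\otimes N}=(\theta_M\otimes\theta_N)\sigma^{\mathfrak R}_{N,M}\sigma^{\mathfrak R}_{M,N}$ and $\theta_{\mathbb 1}=\mathrm{id}$. If $H$ is a Hopf algebra, $\mathcal V_H$ is rigid, and $\theta$ is *ribbon* if $\theta=\theta^!$, where $\theta^!_M$ is the dual morphism of $\theta_{M^\vee}$. **Theorem.** Let $\mathcal V$ be a braided rigid monoidal category admitting a coend $C$, and let $(H,\mathfrak R)$ be a quasitriangular bialgebra in $\mathcal V$, i.e. a bialgebra with an $R$-matrix $\mathfrak R:C\otimes C\to H\otimes H$. (a) There is a bijection between balanced structures $\theta$ on $(\mathcal V_H,\sigma^{\mathfrak R})$ and $C$-balanced elements $\mathfrak t:C\to H$, determined by $\theta_M=r_M(M\otimes\mathfrak t)\delta_M$ for all right $H$-modules $M$. (b) If $H$ is a Hopf algebra, then a balanced structure $\theta$ is ribbon if and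 only if the corresponding $C$-balanced element $\mathfrak t$ is $C$-ribbon. -/

import Mathlib

open CategoryTheory MonoidalCategory BraidedCategory Limits Opposite
open scoped MonObj ComonObj HopfObj

universe v u

noncomputable section

section Modules
variable {V : Type u} [Category.{v} V] [MonoidalCategory V]

/-- Right modules over a monoid object `H` of a monoidal category. -/
structure RMod (H : V) [MonObj H] where
  X : V
  act : X ⊗ H ⟶ X
  act_one : X ◁ η[H] ≫ act = (ρ_ X).hom
  act_mul : X ◁ μ[H] ≫ act = (α_ X H H).inv ≫ act ▷ H ≫ act

namespace RMod
attribute [simp] act_one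

section Cat
variable {H : V} [MonObj H]

/-- Morphisms of right `H`-modules. -/
@[ext]
structure Hom (M N : RMod H) where
  hom : M.X ⟶ N.X
  comm : M.act ≫ hom = hom ▷ H ≫ N.act

instance : Category (RMod H) where
  Hom M N := Hom M N
  id M := ⟨𝟙 M.X, by simp⟩
  comp f g := ⟨f.hom ≫ g.hom, by
    rw [← Category.assoc, f.comm, Category.assoc, g.comm, comp_whiskerRight, Category.assoc]⟩
  id_comp f := Hom.ext (Category.id_comp _)
  comp_id f := Hom.ext (Category.comp_id _)
  assoc f g h := Hom.ext (Category.assoc _ _ _)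

@[ext] lemma hom_ext {M N : RMod H} {f g : M ⟶ N} (h : f.hom = g.hom) : f = g := Hom.ext h
@[simp] lemma id_hom (M : RMod H) : (𝟙 M : M ⟶ M).hom = 𝟙 M.X := rfl
@[simp] lemma comp_hom {M N P : RMod H} (f : M ⟶ N) (g : N ⟶ P) :
    (f ≫ g).hom = f.hom ≫ g.hom := rfl

/-- An isomorphism of `V` that is `H`-linear gives an isomorphism of modules. -/
@[simps] def isoMk {M N : RMod H} (e : M.X ≅ N.X) (h : M.act ≫ e.hom = e.hom ▷ H ≫ N.act) :
    M ≅ N where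
  hom := ⟨e.hom, h⟩
  inv := ⟨e.inv, by
    rw [← cancel_mono e.hom, Category.assoc, Category.assoc, e.inv_hom_id, Category.comp_id, h,
      ← comp_whiskerRight_assoc, e.inv_hom_id, id_whiskerRight, Category.id_comp]⟩
  hom_inv_id := Hom.ext e.hom_inv_id
  inv_hom_id := Hom.ext e.inv_hom_id
end Cat

section Tensor
variable [BraidedCategory V] {H : V} [BimonObj H]

/-- The diagonal action of `H` on a tensor product. -/
def tAct {X Y : V} (r : X ⊗ H ⟶ X) (s : Y ⊗ H ⟶ Y) : (X ⊗ Y) ⊗ H ⟶ X ⊗ Y :=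
  (X ⊗ Y) ◁ Δ[H] ≫ tensorμ X Y H H ≫ (r ⊗ₘ s)

lemma tAct_one {X Y : V} (r : X ⊗ H ⟶ X) (s : Y ⊗ H ⟶ Y)
    (hr : X ◁ η[H] ≫ r = (ρ_ X).hom) (hs : Y ◁ η[H] ≫ s = (ρ_ Y).hom) :
    (X ⊗ Y) ◁ η[H] ≫ tAct r s = (ρ_ (X ⊗ Y)).hom := by
  unfold tAct
  rw [← whiskerLeft_comp_assoc, Bimon.one_comul, whiskerLeft_comp_assoc,
    tensorμ_natural_right_assoc, tensorHom_comp_tensorHom, hr, hs,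
    ← tensor_right_unitality]

lemma tAct_mul {X Y : V} (r : X ⊗ H ⟶ X) (s : Y ⊗ H ⟶ Y)
    (hr : X ◁ μ[H] ≫ r = (α_ X H H).inv ≫ r ▷ H ≫ r)
    (hs : Y ◁ μ[H] ≫ s = (α_ Y H H).inv ≫ s ▷ H ≫ s) :
    (X ⊗ Y) ◁ μ[H] ≫ tAct r s = (α_ (X ⊗ Y) H H).inv ≫ tAct r s ▷ H ≫ tAct r s := by
  unfold tAct
  rw [← whiskerLeft_comp_assoc, BimonObj.mul_comul]
  simp only [whiskerLeft_comp, Category.assoc, comp_whiskerRight]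
  rw [tensorμ_natural_right_assoc, tensorHom_comp_tensorHom, hr, hs,
    ← whisker_exchange_assoc, ← whisker_exchange_assoc, ← whisker_exchange_assoc,
    tensorμ_natural_left_assoc, tensorHom_comp_tensorHom]
  have h := tensor_associativity X Y H H H H
  have h2 : (tensorμ X Y H H ▷ (H ⊗ H)) ≫ tensorμ (X ⊗ H) (Y ⊗ H) H H =
    (α_ (X ⊗ Y) (H ⊗ H) (H ⊗ H)).hom ≫
      ((X ⊗ Y) ◁ tensorμ H H H H) ≫ tensorμ X Y (H ⊗ H) (H ⊗ H) ≫
      ((α_ X H H).inv ⊗ₘ (α_ Y H H).inv) := by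
    rw [← cancel_mono ((α_ X H H).hom ⊗ₘ (α_ Y H H).hom)]
    simp only [Category.assoc]
    rw [h, tensorHom_comp_tensorHom]
    simp
  rw [whisker_exchange_assoc, reassoc_of% h2]
  simp only [← tensorHom_comp_tensorHom]
  simp [MonoidalCategory.tensorHom_def]

lemma tAct_comm {X Y X' Y' : V} (r : X ⊗ H ⟶ X) (s : Y ⊗ H ⟶ Y)
    (r' : X' ⊗ H ⟶ X') (s' : Y' ⊗ H ⟶ Y') (f : X ⟶ X') (g : Y ⟶ Y')
    (hf : r ≫ f = f ▷ H ≫ r') (hg : s ≫ g = g ▷ H ≫ s') :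
    tAct r s ≫ (f ⊗ₘ g) = (f ⊗ₘ g) ▷ H ≫ tAct r' s' := by
  unfold tAct
  rw [← whisker_exchange_assoc, tensorμ_natural_left_assoc]
  simp only [Category.assoc, tensorHom_comp_tensorHom, hf, hg]

lemma tAct_assoc {X Y Z : V} (r : X ⊗ H ⟶ X) (s : Y ⊗ H ⟶ Y) (t : Z ⊗ H ⟶ Z) :
    tAct (tAct r s) t ≫ (α_ X Y Z).hom = (α_ X Y Z).hom ▷ H ≫ tAct r (tAct s t) := by
  have e1 : tAct (tAct r s) t =
      ((X ⊗ Y) ⊗ Z) ◁ (Δ[H] ≫ (Δ[H] ⊗ₘ 𝟙 H)) ≫ tensorμ (X ⊗ Y) Z (H ⊗ H) H ≫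
        (tensorμ X Y H H ▷ (Z ⊗ H)) ≫ ((r ⊗ₘ s) ⊗ₘ t) := by
    rw [whiskerLeft_comp_assoc, tensorμ_natural_right_assoc]
    simp only [← tensorHom_id (tensorμ X Y H H), tensorHom_comp_tensorHom, whiskerLeft_id,
      Category.id_comp]
    rfl
  have e2 : tAct r (tAct s t) =
      (X ⊗ Y ⊗ Z) ◁ (Δ[H] ≫ (𝟙 H ⊗ₘ Δ[H])) ≫ tensorμ X (Y ⊗ Z) H (H ⊗ H) ≫
        ((X ⊗ H) ◁ tensorμ Y Z H H) ≫ (r ⊗ₘ (s ⊗ₘ t)) := by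
    rw [whiskerLeft_comp_assoc, tensorμ_natural_right_assoc]
    simp only [← id_tensorHom (X ⊗ H), tensorHom_comp_tensorHom, whiskerLeft_id,
      Category.id_comp]
    rfl
  rw [e1, e2]
  simp only [Category.assoc]
  rw [MonoidalCategory.associator_naturality, associator_monoidal_assoc,
    MonoidalCategory.tensorHom_def_assoc (α_ X Y Z).hom, whisker_exchange_assoc,
    ← whiskerLeft_comp_assoc]
  simp

lemma tAct_left {X : V} (r : X ⊗ H ⟶ X) :
    tAct ((λ_ H).hom ≫ ε[H]) r ≫ (λ_ X).hom = (λ_ X).hom ▷ H ≫ r := by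
  have e : tAct ((λ_ H).hom ≫ ε[H]) r = (𝟙_ V ⊗ X) ◁ (Δ[H] ≫ (ε[H] ⊗ₘ 𝟙 H)) ≫
      tensorμ (𝟙_ V) X (𝟙_ V) H ≫ ((λ_ (𝟙_ V)).hom ⊗ₘ r) := by
    rw [whiskerLeft_comp_assoc, tensorμ_natural_right_assoc, tensorHom_comp_tensorHom,
      leftUnitor_naturality, whiskerLeft_id, Category.id_comp]
    rfl
  have h := leftUnitor_monoidal X H
  rw [e, MonoidalCategory.tensorHom_def (λ_ (𝟙_ V)).hom r]
  simp only [Category.assoc]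
  rw [leftUnitor_naturality, ← reassoc_of% h, tensorHom_id, ComonObj.counit_comul]
  simp [MonoidalCategory.tensorHom_def]

lemma tAct_right {X : V} (r : X ⊗ H ⟶ X) :
    tAct r ((λ_ H).hom ≫ ε[H]) ≫ (ρ_ X).hom = (ρ_ X).hom ▷ H ≫ r := by
  have e : tAct r ((λ_ H).hom ≫ ε[H]) = (X ⊗ 𝟙_ V) ◁ (Δ[H] ≫ (𝟙 H ⊗ₘ ε[H])) ≫
      tensorμ X (𝟙_ V) H (𝟙_ V) ≫ (r ⊗ₘ (λ_ (𝟙_ V)).hom) := by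
    rw [whiskerLeft_comp_assoc, tensorμ_natural_right_assoc, tensorHom_comp_tensorHom,
      leftUnitor_naturality, whiskerLeft_id, Category.id_comp]
    rfl
  have h := rightUnitor_monoidal X H
  rw [e, MonoidalCategory.tensorHom_def' r (λ_ (𝟙_ V)).hom]
  simp only [Category.assoc]
  rw [rightUnitor_naturality, ← reassoc_of% h, id_tensorHom, ComonObj.comul_counit]
  simp [MonoidalCategory.tensorHom_def]

/-- The trivial module: `H` acts on the unit object through its counit. -/
@[simps] def unit (H : V) [BimonObj H] : RMod H where
  X := 𝟙_ V
  act := (λ_ H).hom ≫ ε[H]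
  act_one := by
    rw [leftUnitor_naturality_assoc, BimonObj.one_counit, Category.comp_id, unitors_equal]
  act_mul := by
    rw [leftUnitor_naturality_assoc, Bimon.mul_counit]
    simp [MonoidalCategory.tensorHom_def]

/-- The tensor product of two right modules, with the diagonal action. -/
@[simps] def tensor (M N : RMod H) : RMod H where
  X := M.X ⊗ N.X
  act := tAct M.act N.act
  act_one := tAct_one _ _ M.act_one N.act_one
  act_mul := tAct_mul _ _ M.act_mul N.act_mul

/-- The monoidal category of right `H`-modules. -/
instance : MonoidalCategory (RMod H) where
  tensorObj := tensor
  tensorUnit := unit H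
  tensorHom f g := ⟨f.hom ⊗ₘ g.hom, tAct_comm _ _ _ _ _ _ f.comm g.comm⟩
  whiskerLeft M _ _ f := ⟨M.X ◁ f.hom, by
    have h := tAct_comm M.act _ M.act _ (𝟙 M.X) f.hom (by simp) f.comm
    rwa [id_tensorHom] at h⟩
  whiskerRight f M := ⟨f.hom ▷ M.X, by
    have h := tAct_comm _ M.act _ M.act f.hom (𝟙 M.X) f.comm (by simp)
    rwa [tensorHom_id] at h⟩
  associator M N P := isoMk (α_ M.X N.X P.X) (tAct_assoc _ _ _)
  leftUnitor M := isoMk (λ_ M.X) (tAct_left _)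
  rightUnitor M := isoMk (ρ_ M.X) (tAct_right _)
  tensorHom_def _ _ := Hom.ext (MonoidalCategory.tensorHom_def _ _)
  id_tensorHom_id _ _ := Hom.ext (id_tensorHom_id _ _)
  tensorHom_comp_tensorHom _ _ _ _ := Hom.ext (tensorHom_comp_tensorHom _ _ _ _)
  whiskerLeft_id _ _ := Hom.ext (MonoidalCategory.whiskerLeft_id _ _)
  id_whiskerRight _ _ := Hom.ext (MonoidalCategory.id_whiskerRight _ _)
  associator_naturality _ _ _ := Hom.ext (MonoidalCategory.associator_naturality _ _ _)
  leftUnitor_naturality _ := Hom.ext (MonoidalCategory.leftUnitor_naturality _)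
  rightUnitor_naturality _ := Hom.ext (MonoidalCategory.rightUnitor_naturality _)
  pentagon _ _ _ _ := Hom.ext (MonoidalCategory.pentagon _ _ _ _)
  triangle _ _ := Hom.ext (MonoidalCategory.triangle _ _)

end Tensor

section Dual
open ExactPairing
variable {X D : V} [ExactPairing D X]

lemma ev_ext {W Z : V} {f g : W ⟶ D ⊗ Z}
    (h : X ◁ f ≫ (α_ X D Z).inv ≫ ε_ D X ▷ Z = X ◁ g ≫ (α_ X D Z).inv ≫ ε_ D X ▷ Z) : f = g := by
  apply (tensorLeftHomEquiv W D X Z).symm.injective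
  change X ◁ f ≫ (α_ _ _ _).inv ≫ ε_ _ _ ▷ _ ≫ (λ_ _).hom =
    X ◁ g ≫ (α_ _ _ _).inv ≫ ε_ _ _ ▷ _ ≫ (λ_ _).hom
  simpa using h =≫ (λ_ Z).hom

lemma ev_ext' {W : V} {f g : W ⟶ D} (h : X ◁ f ≫ ε_ D X = X ◁ g ≫ ε_ D X) : f = g := by
  rw [← cancel_mono (ρ_ D).inv]
  apply ev_ext (X := X)
  have e (k : W ⟶ D) : X ◁ (k ≫ (ρ_ D).inv) ≫ (α_ X D (𝟙_ V)).inv ≫ ε_ D X ▷ (𝟙_ V) =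
      (X ◁ k ≫ ε_ D X) ≫ (ρ_ (𝟙_ V)).inv := by
    monoidal
  rw [e, e, h]

variable [BraidedCategory V] {H : V}

/-- The pairing `X ⊗ (D ⊗ H) ⟶ 𝟙_`, `(x, d, h) ↦ ev (a (x, h), d)`. -/
def dPair (a : X ⊗ H ⟶ X) : X ⊗ D ⊗ H ⟶ 𝟙_ V :=
  X ◁ (β_ D H).hom ≫ (α_ X H D).inv ≫ a ▷ D ≫ ε_ D X

/-- The map `D ⊗ H ⟶ D` adjoint to `a : X ⊗ H ⟶ X`. -/
def dAct (a : X ⊗ H ⟶ X) : D ⊗ H ⟶ D :=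
  tensorLeftHomEquiv (D ⊗ H) D X (𝟙_ V) (dPair a) ≫ (ρ_ D).hom

lemma dAct_ev (a : X ⊗ H ⟶ X) : X ◁ (dAct a : D ⊗ H ⟶ D) ≫ ε_ D X = dPair a := by
  have h := (tensorLeftHomEquiv (D ⊗ H) D X (𝟙_ V)).symm_apply_apply (dPair a)
  rw [← h]
  change _ = X ◁ (tensorLeftHomEquiv (D ⊗ H) D X (𝟙_ V) (dPair a)) ≫
    (α_ _ _ _).inv ≫ ε_ _ _ ▷ _ ≫ (λ_ _).hom
  rw [dAct]
  monoidal

lemma dAct_one [MonObj H] (a : X ⊗ H ⟶ X) (h : X ◁ η[H] ≫ a = (ρ_ X).hom) :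
    D ◁ η[H] ≫ (dAct a : D ⊗ H ⟶ D) = (ρ_ D).hom := by
  apply ev_ext' (X := X)
  rw [whiskerLeft_comp, Category.assoc, dAct_ev, dPair, ← whiskerLeft_comp_assoc,
    braiding_naturality_right, whiskerLeft_comp_assoc]
  rw [associator_inv_naturality_middle_assoc, ← comp_whiskerRight_assoc, h]
  simp

lemma dAct_mul [MonObj H] (a : X ⊗ H ⟶ X)
    (h : X ◁ μ[H] ≫ a = X ◁ (β_ H H).hom ≫ (α_ X H H).inv ≫ a ▷ H ≫ a) :
    D ◁ μ[H] ≫ (dAct a : D ⊗ H ⟶ D) = (α_ D H H).inv ≫ dAct a ▷ H ≫ dAct a := by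
  apply ev_ext' (X := X)
  simp only [whiskerLeft_comp, Category.assoc, dAct_ev]
  have e1 : X ◁ D ◁ μ[H] ≫ dPair a =
      𝟙 _ ⊗≫ X ◁ (β_ D (H ⊗ H)).hom ⊗≫ (X ◁ μ[H] ≫ a) ▷ D ≫ ε_ D X := by
    rw [dPair, ← whiskerLeft_comp_assoc, braiding_naturality_right]
    monoidal
  have e2 : X ◁ (dAct a : D ⊗ H ⟶ D) ▷ H ≫ dPair a =
      𝟙 _ ⊗≫ X ◁ ((dAct a : D ⊗ H ⟶ D) ▷ H ≫ (β_ D H).hom) ⊗≫ a ▷ D ⊗≫ ε_ D X := by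
    rw [dPair]; monoidal
  have e3 : X ◁ (dAct a : D ⊗ H ⟶ D) ▷ H ≫ dPair a =
      𝟙 _ ⊗≫ X ◁ (β_ (D ⊗ H) H).hom ⊗≫ a ▷ (D ⊗ H) ⊗≫ X ◁ (β_ D H).hom ⊗≫ a ▷ D ≫ ε_ D X := by
    rw [e2, braiding_naturality_left]
    calc _ = 𝟙 _ ⊗≫ X ◁ (β_ (D ⊗ H) H).hom ⊗≫ ((X ⊗ H) ◁ (dAct a : D ⊗ H ⟶ D) ≫ a ▷ D) ⊗≫ ε_ D X := by
          monoidal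
      _ = 𝟙 _ ⊗≫ X ◁ (β_ (D ⊗ H) H).hom ⊗≫ a ▷ (D ⊗ H) ⊗≫ (X ◁ (dAct a : D ⊗ H ⟶ D) ≫ ε_ D X) := by
          rw [whisker_exchange]; monoidal
      _ = _ := by rw [dAct_ev, dPair]; monoidal
  have hyb : 𝟙 ((D ⊗ H) ⊗ H) ⊗≫ (β_ D H).hom ▷ H ⊗≫ H ◁ (β_ D H).hom ⊗≫ (β_ H H).hom ▷ D =
      𝟙 _ ⊗≫ D ◁ (β_ H H).hom ⊗≫ (β_ D H).hom ▷ H ⊗≫ H ◁ (β_ D H).hom ⊗≫ 𝟙 ((H ⊗ H) ⊗ D) := by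
    have k := braiding_naturality_right D (β_ H H).hom
    rw [braiding_tensor_right_hom] at k
    calc _ = 𝟙 _ ⊗≫ ((α_ D H H).inv ≫ (β_ D H).hom ▷ H ≫ (α_ H D H).hom ≫ H ◁ (β_ D H).hom ≫
          (α_ H H D).inv) ≫ (β_ H H).hom ▷ D := by monoidal
      _ = _ := by
        simp only [Category.assoc] at k ⊢
        rw [← k]; monoidal
  rw [e1, e3, h]
  simp only [braiding_tensor_left_hom, braiding_tensor_right_hom]
  calc _ = 𝟙 _ ⊗≫ X ◁ (𝟙 ((D ⊗ H) ⊗ H) ⊗≫ (β_ D H).hom ▷ H ⊗≫ H ◁ (β_ D H).hom ⊗≫ (β_ H H).hom ▷ D) ⊗≫ a ▷ H ▷ D ⊗≫ a ▷ D ≫ ε_ D X := by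
        monoidal
    _ = 𝟙 _ ⊗≫ X ◁ (𝟙 _ ⊗≫ D ◁ (β_ H H).hom ⊗≫ (β_ D H).hom ▷ H ⊗≫ H ◁ (β_ D H).hom ⊗≫ 𝟙 ((H ⊗ H) ⊗ D)) ⊗≫ a ▷ H ▷ D ⊗≫ a ▷ D ≫ ε_ D X := by
        rw [hyb]
    _ = 𝟙 _ ⊗≫ X ◁ (D ◁ (β_ H H).hom ⊗≫ (β_ D H).hom ▷ H) ⊗≫ ((X ⊗ H) ◁ (β_ D H).hom ≫ a ▷ (H ⊗ D)) ⊗≫ a ▷ D ≫ ε_ D X := by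
        monoidal
    _ = _ := by rw [whisker_exchange]; monoidal

lemma dAct_ev_linear [BimonObj H] (r a : X ⊗ H ⟶ X)
    (h : X ◁ Δ[H] ≫ (α_ X H H).inv ≫ r ▷ H ≫ a = X ◁ ε[H] ≫ (ρ_ X).hom) :
    tAct r (dAct a : D ⊗ H ⟶ D) ≫ ε_ D X = ε_ D X ▷ H ≫ (λ_ H).hom ≫ ε[H] := by
  calc _ = 𝟙 _ ⊗≫ X ◁ D ◁ Δ[H] ⊗≫ X ◁ (β_ D H).hom ▷ H ⊗≫ r ▷ (D ⊗ H) ⊗≫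
        (X ◁ (dAct a : D ⊗ H ⟶ D) ≫ ε_ D X) := by
        rw [tAct, tensorμ, MonoidalCategory.tensorHom_def]; monoidal
    _ = 𝟙 _ ⊗≫ X ◁ D ◁ Δ[H] ⊗≫ X ◁ (β_ D H).hom ▷ H ⊗≫ (r ▷ (D ⊗ H) ≫ X ◁ (β_ D H).hom) ⊗≫
        a ▷ D ⊗≫ ε_ D X := by
        rw [dAct_ev, dPair]; monoidal
    _ = 𝟙 _ ⊗≫ X ◁ (D ◁ Δ[H] ≫ (β_ D (H ⊗ H)).hom) ⊗≫ r ▷ H ▷ D ⊗≫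
        a ▷ D ⊗≫ ε_ D X := by
        rw [← whisker_exchange, braiding_tensor_right_hom]; monoidal
    _ = 𝟙 _ ⊗≫ X ◁ (β_ D H).hom ⊗≫ (X ◁ Δ[H] ≫ (α_ X H H).inv ≫ r ▷ H ≫ a) ▷ D ⊗≫ ε_ D X := by
        rw [braiding_naturality_right]; monoidal
    _ = 𝟙 _ ⊗≫ X ◁ ((β_ D H).hom ≫ ε[H] ▷ D) ⊗≫ ε_ D X := by
        rw [h]; monoidal
    _ = 𝟙 _ ⊗≫ ((X ⊗ D) ◁ ε[H] ≫ ε_ D X ▷ 𝟙_ V) ⊗≫ 𝟙 (𝟙_ V) := by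
        rw [← braiding_naturality_right, braiding_tensorUnit_right]; monoidal
    _ = _ := by
        rw [whisker_exchange]; monoidal

lemma dAct_coev_linear [BimonObj H] (r a : X ⊗ H ⟶ X)
    (h : X ◁ Δ[H] ≫ (α_ X H H).inv ≫ a ▷ H ≫ r = X ◁ ε[H] ≫ (ρ_ X).hom) :
    ((λ_ H).hom ≫ ε[H]) ≫ η_ D X = η_ D X ▷ H ≫ tAct (dAct a : D ⊗ H ⟶ D) r := by
  apply ev_ext (X := X)
  have hz := coevaluation_evaluation'' D X
  symm
  calc _ = 𝟙 _ ⊗≫ X ◁ η_ D X ▷ H ⊗≫ X ◁ D ◁ X ◁ Δ[H] ⊗≫ X ◁ D ◁ (β_ X H).hom ▷ H ⊗≫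
        ((X ⊗ (D ⊗ H)) ◁ r ≫ (X ◁ (dAct a : D ⊗ H ⟶ D) ≫ ε_ D X) ▷ X) ⊗≫ 𝟙 (𝟙_ V ⊗ X) := by
        rw [tAct, tensorμ, MonoidalCategory.tensorHom_def']; monoidal
    _ = 𝟙 _ ⊗≫ X ◁ η_ D X ▷ H ⊗≫ X ◁ D ◁ X ◁ Δ[H] ⊗≫ X ◁ D ◁ (β_ X H).hom ▷ H ⊗≫
        X ◁ (β_ D H).hom ▷ (X ⊗ H) ⊗≫ a ▷ (D ⊗ X ⊗ H) ⊗≫ ε_ D X ▷ (X ⊗ H) ⊗≫ r ⊗≫ 𝟙 (𝟙_ V ⊗ X) := by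
        rw [dAct_ev, whisker_exchange, dPair]; monoidal
    _ = 𝟙 _ ⊗≫ ((X ◁ η_ D X) ▷ H ≫ (X ⊗ (D ⊗ X)) ◁ Δ[H]) ⊗≫
        X ◁ (β_ (D ⊗ X) H).hom ▷ H ⊗≫ a ▷ (D ⊗ X ⊗ H) ⊗≫ ε_ D X ▷ (X ⊗ H) ⊗≫ r ⊗≫ 𝟙 (𝟙_ V ⊗ X) := by
        rw [braiding_tensor_left_hom]; monoidal
    _ = 𝟙 _ ⊗≫ X ◁ Δ[H] ⊗≫ X ◁ (η_ D X ▷ H ≫ (β_ (D ⊗ X) H).hom) ▷ H ⊗≫ a ▷ (D ⊗ X ⊗ H) ⊗≫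
        ε_ D X ▷ (X ⊗ H) ⊗≫ r ⊗≫ 𝟙 (𝟙_ V ⊗ X) := by
        rw [← whisker_exchange]; monoidal
    _ = 𝟙 _ ⊗≫ X ◁ Δ[H] ⊗≫ ((X ⊗ H) ◁ η_ D X ≫ a ▷ (D ⊗ X)) ▷ H ⊗≫
        ε_ D X ▷ (X ⊗ H) ⊗≫ r ⊗≫ 𝟙 (𝟙_ V ⊗ X) := by
        rw [braiding_naturality_left, braiding_tensorUnit_left]; monoidal
    _ = 𝟙 _ ⊗≫ X ◁ Δ[H] ⊗≫ a ▷ H ⊗≫ (X ◁ η_ D X ⊗≫ ε_ D X ▷ X) ▷ H ⊗≫ r ⊗≫ 𝟙 (𝟙_ V ⊗ X) := by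
        rw [whisker_exchange]; monoidal
    _ = 𝟙 _ ⊗≫ (X ◁ Δ[H] ≫ (α_ X H H).inv ≫ a ▷ H ≫ r) ⊗≫ 𝟙 (𝟙_ V ⊗ X) := by
        rw [hz]; monoidal
    _ = 𝟙 _ ⊗≫ X ◁ ε[H] ⊗≫ (X ◁ η_ D X ⊗≫ ε_ D X ▷ X) ⊗≫ 𝟙 (𝟙_ V ⊗ X) := by
        rw [h, hz]; monoidal
    _ = _ := by monoidal
end Dual

section DualModule
open ExactPairing
variable [BraidedCategory V] {H : V} [HopfObj H]

lemma act_antipode_right (M : RMod H) :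
    M.X ◁ Δ[H] ≫ (α_ M.X H H).inv ≫ M.act ▷ H ≫ M.X ◁ 𝒮[H] ≫ M.act =
      M.X ◁ ε[H] ≫ (ρ_ M.X).hom := by
  rw [← whisker_exchange_assoc]
  have h := M.act_mul
  calc _ = M.X ◁ (Δ[H] ≫ H ◁ 𝒮[H]) ≫ (α_ M.X H H).inv ≫ M.act ▷ H ≫ M.act := by
        simp
    _ = M.X ◁ (Δ[H] ≫ H ◁ 𝒮[H] ≫ μ[H]) ≫ M.act := by
        rw [whiskerLeft_comp_assoc, whiskerLeft_comp_assoc, whiskerLeft_comp_assoc, h]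
    _ = _ := by
      rw [HopfObj.antipode_right, whiskerLeft_comp_assoc, M.act_one]

lemma act_antipode_left (M : RMod H) :
    M.X ◁ Δ[H] ≫ (α_ M.X H H).inv ≫ (M.X ◁ 𝒮[H] ≫ M.act) ▷ H ≫ M.act =
      M.X ◁ ε[H] ≫ (ρ_ M.X).hom := by
  have h := M.act_mul
  calc _ = M.X ◁ (Δ[H] ≫ 𝒮[H] ▷ H) ≫ (α_ M.X H H).inv ≫ M.act ▷ H ≫ M.act := by
        simp
    _ = M.X ◁ (Δ[H] ≫ 𝒮[H] ▷ H ≫ μ[H]) ≫ M.act := by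
        rw [whiskerLeft_comp_assoc, whiskerLeft_comp_assoc, whiskerLeft_comp_assoc, h]
    _ = _ := by
      rw [HopfObj.antipode_left, whiskerLeft_comp_assoc, M.act_one]

variable [LeftRigidCategory V]

/-- The dual module `ᘁM` of `M` (with `ev : M ⊗ ᘁM ⟶ 𝟙_` and `coev : 𝟙_ ⟶ ᘁM ⊗ M`):
the element `h` acts on `ᘁM` as the adjoint of the action of the antipode of `h` on `M`. -/
@[simps] def dual (M : RMod H) : RMod H where
  X := (ᘁM.X : V)
  act := dAct (M.X ◁ 𝒮[H] ≫ M.act)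
  act_one := dAct_one _ (by
    rw [← whiskerLeft_comp_assoc, HopfObj.one_antipode, M.act_one])
  act_mul := dAct_mul _ (by
    rw [← whiskerLeft_comp_assoc, HopfObj.mul_antipode]
    simp only [whiskerLeft_comp, Category.assoc, M.act_mul]
    rw [← whiskerLeft_comp_assoc, braiding_naturality, whiskerLeft_comp_assoc,
      MonoidalCategory.tensorHom_def]
    congr 1
    simp only [whiskerLeft_comp, comp_whiskerRight, Category.assoc]
    rw [← whisker_exchange_assoc]
    simp)

/-- `M` and its dual module form a dual pair in the category of right modules. -/
instance (M : RMod H) : ExactPairing (dual M) M where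
  coevaluation' := ⟨η_ (ᘁM.X : V) M.X, dAct_coev_linear (D := (ᘁM.X : V)) _ _ (act_antipode_left M)⟩
  evaluation' := ⟨ε_ (ᘁM.X : V) M.X, dAct_ev_linear (D := (ᘁM.X : V)) _ _ (act_antipode_right M)⟩
  coevaluation_evaluation' := Hom.ext (ExactPairing.coevaluation_evaluation (ᘁM.X : V) M.X)
  evaluation_coevaluation' := Hom.ext (ExactPairing.evaluation_coevaluation (ᘁM.X : V) M.X)

instance : LeftRigidCategory (RMod H) where
  leftDual M := { leftDual := dual M }

end DualModule
end RMod
end Modules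

section Coend
open ExactPairing
variable (V : Type u) [Category.{v} V] [MonoidalCategory V] [RigidCategory V]

/-- The functor `(X, Y) ↦ Xᘁ ⊗ Y`. Here `Xᘁ` is the dual of `X` with
`ev : Xᘁ ⊗ X ⟶ 𝟙_` and `coev : 𝟙_ ⟶ X ⊗ Xᘁ`. -/
@[simps] def dualTensor : Vᵒᵖ ⥤ V ⥤ V where
  obj X := tensorLeft (X.unop)ᘁ
  map f := (curriedTensor V).map ((f.unop)ᘁ)
  map_id X := by
    ext Y
    simp [rightAdjointMate_id]
  map_comp f g := by
    ext Y
    simp [comp_rightAdjointMate]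

/-- A coend of `V`: a coend `∫^X Xᘁ ⊗ X`. -/
structure CoendData where
  cowedge : Cowedge (dualTensor V)
  isColimit : IsColimit cowedge

variable {V}
namespace CoendData
variable (K : CoendData V)

/-- The underlying object of the coend. -/
abbrev C : V := K.cowedge.pt

/-- The universal dinatural transformation. -/
def inj (X : V) : Xᘁ ⊗ X ⟶ K.C := K.cowedge.π X

lemma inj_dinatural {X Y : V} (f : X ⟶ Y) : fᘁ ▷ X ≫ K.inj X = Yᘁ ◁ f ≫ K.inj Y :=
  Cowedge.condition K.cowedge f

/-- The universal coaction. -/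
def coact (X : V) : X ⟶ X ⊗ K.C :=
  (λ_ X).inv ≫ η_ X Xᘁ ▷ X ≫ (α_ X Xᘁ X).hom ≫ X ◁ K.inj X

lemma coact_naturality {X Y : V} (f : X ⟶ Y) : f ≫ K.coact Y = K.coact X ≫ f ▷ K.C := by
  have h : η_ Y Yᘁ ≫ Y ◁ (fᘁ : Yᘁ ⟶ Xᘁ) = η_ X Xᘁ ≫ f ▷ Xᘁ := coevaluation_comp_rightAdjointMate f
  calc _ = 𝟙 _ ⊗≫ (𝟙_ V ◁ f ≫ η_ Y Yᘁ ▷ Y) ⊗≫ Y ◁ K.inj Y := by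
        rw [coact]; monoidal
    _ = 𝟙 _ ⊗≫ η_ Y Yᘁ ▷ X ⊗≫ Y ◁ (Yᘁ ◁ f ≫ K.inj Y) := by
        rw [whisker_exchange]; monoidal
    _ = 𝟙 _ ⊗≫ (η_ Y Yᘁ ≫ Y ◁ (fᘁ : Yᘁ ⟶ Xᘁ)) ▷ X ⊗≫ Y ◁ K.inj X := by
        rw [← inj_dinatural]; monoidal
    _ = 𝟙 _ ⊗≫ η_ X Xᘁ ▷ X ⊗≫ (f ▷ (Xᘁ ⊗ X) ≫ Y ◁ K.inj X) := by
        rw [h]; monoidal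
    _ = _ := by
        rw [← whisker_exchange, coact]; monoidal

lemma inj_eq (X : V) : Xᘁ ◁ K.coact X ≫ (α_ Xᘁ X K.C).inv ≫ ε_ X Xᘁ ▷ K.C ≫ (λ_ K.C).hom =
    K.inj X := by
  have hz := coevaluation_evaluation'' X Xᘁ
  calc _ = 𝟙 _ ⊗≫ (Xᘁ : V) ◁ η_ X Xᘁ ▷ X ⊗≫ ((Xᘁ ⊗ X) ◁ K.inj X ≫ ε_ X Xᘁ ▷ K.C) ⊗≫ 𝟙 K.C := by
        rw [coact]; monoidal
    _ = 𝟙 _ ⊗≫ ((Xᘁ : V) ◁ η_ X Xᘁ ⊗≫ ε_ X Xᘁ ▷ (Xᘁ : V)) ▷ X ⊗≫ K.inj X := by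
        rw [whisker_exchange]; monoidal
    _ = _ := by rw [hz]; monoidal

/-- The universal property of the coend. -/
def desc {D : V} (f : ∀ X : V, Xᘁ ⊗ X ⟶ D)
    (hf : ∀ {X Y : V} (g : X ⟶ Y), gᘁ ▷ X ≫ f X = Yᘁ ◁ g ≫ f Y) : K.C ⟶ D :=
  Cowedge.IsColimit.desc K.isColimit f (fun _ _ g => hf g)

lemma inj_desc {D : V} (f : ∀ X : V, Xᘁ ⊗ X ⟶ D)
    (hf : ∀ {X Y : V} (g : X ⟶ Y), gᘁ ▷ X ≫ f X = Yᘁ ◁ g ≫ f Y) (X : V) :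
    K.inj X ≫ K.desc f hf = f X :=
  Cowedge.IsColimit.π_desc K.isColimit f (fun _ _ g => hf g) X

lemma hom_ext {D : V} {f g : K.C ⟶ D} (h : ∀ X : V, K.inj X ≫ f = K.inj X ≫ g) : f = g :=
  Cowedge.IsColimit.hom_ext K.isColimit h

/-- From `X ⟶ X ⊗ D` to `Xᘁ ⊗ X ⟶ D`. -/
def bend {X D : V} (b : X ⟶ X ⊗ D) : Xᘁ ⊗ X ⟶ D :=
  Xᘁ ◁ b ≫ (α_ Xᘁ X D).inv ≫ ε_ X Xᘁ ▷ D ≫ (λ_ D).hom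

lemma inj_comp (X : V) {D : V} (k : K.C ⟶ D) :
    K.inj X ≫ k = bend (K.coact X ≫ X ◁ k) := by
  rw [← inj_eq]
  calc _ = 𝟙 _ ⊗≫ (Xᘁ : V) ◁ K.coact X ⊗≫ (ε_ X Xᘁ ▷ K.C ≫ 𝟙_ V ◁ k) ⊗≫ 𝟙 D := by monoidal
    _ = _ := by rw [← whisker_exchange, bend]; monoidal

lemma hom_ext_coact {D : V} {f g : K.C ⟶ D} (h : ∀ X, K.coact X ≫ X ◁ f = K.coact X ≫ X ◁ g) :
    f = g := by
  apply K.hom_ext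
  intro X
  rw [inj_comp, inj_comp, h]

lemma bend_dinatural {X Y D : V} (f : X ⟶ Y) (b : X ⟶ X ⊗ D) (b' : Y ⟶ Y ⊗ D)
    (n : f ≫ b' = b ≫ f ▷ D) : fᘁ ▷ X ≫ bend b = Yᘁ ◁ f ≫ bend b' := by
  have h : (Yᘁ : V) ◁ f ≫ ε_ Y Yᘁ = (fᘁ : Yᘁ ⟶ Xᘁ) ▷ X ≫ ε_ X Xᘁ :=
    (rightAdjointMate_comp_evaluation f).symm
  symm
  calc _ = Yᘁ ◁ (f ≫ b') ⊗≫ ε_ Y Yᘁ ▷ D ⊗≫ 𝟙 D := by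
        rw [bend]; monoidal
    _ = Yᘁ ◁ b ⊗≫ ((Yᘁ : V) ◁ f ≫ ε_ Y Yᘁ) ▷ D ⊗≫ 𝟙 D := by
        rw [n]; monoidal
    _ = ((Yᘁ : V) ◁ b ≫ (fᘁ : Yᘁ ⟶ Xᘁ) ▷ (X ⊗ D)) ⊗≫ ε_ X Xᘁ ▷ D ⊗≫ 𝟙 D := by
        rw [h]; monoidal
    _ = _ := by
        rw [whisker_exchange, bend]; monoidal

lemma unbend {X D : V} (b : X ⟶ X ⊗ D) :
    (λ_ X).inv ≫ η_ X Xᘁ ▷ X ≫ (α_ X Xᘁ X).hom ≫ X ◁ bend b = b := by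
  have hz := evaluation_coevaluation'' X Xᘁ
  calc _ = 𝟙 _ ⊗≫ (η_ X Xᘁ ▷ X ≫ (X ⊗ Xᘁ) ◁ b) ⊗≫ X ◁ ε_ X Xᘁ ▷ D ⊗≫ 𝟙 (X ⊗ D) := by
        rw [bend]; monoidal
    _ = 𝟙 _ ⊗≫ b ⊗≫ (η_ X Xᘁ ▷ X ⊗≫ X ◁ ε_ X Xᘁ) ▷ D ⊗≫ 𝟙 (X ⊗ D) := by
        rw [← whisker_exchange]; monoidal
    _ = _ := by rw [hz]; monoidal

/-- The bijection `f ↦ (X ⊗ f) δ_X` between morphisms `C ⟶ D` and natural transformations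
`X ⟶ X ⊗ D`. -/
def sigma₁ (D : V) : (K.C ⟶ D) ≃ (𝟭 V ⟶ tensorRight D) where
  toFun f :=
    { app := fun X => K.coact X ≫ X ◁ f
      naturality := fun X Y g => by
        change g ≫ K.coact Y ≫ Y ◁ f = (K.coact X ≫ X ◁ f) ≫ g ▷ D
        rw [← Category.assoc, coact_naturality, Category.assoc, Category.assoc, whisker_exchange] }
  invFun a := K.desc (fun X => bend (a.app X)) (fun g => bend_dinatural g _ _ (a.naturality g))
  left_inv f := by
    apply K.hom_ext
    intro X
    rw [inj_desc, inj_comp]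
  right_inv a := by
    ext X
    change K.coact X ≫ X ◁ K.desc _ _ = a.app X
    rw [coact]
    simp only [Category.assoc, ← whiskerLeft_comp, inj_desc]
    exact unbend _

lemma sigma₁_symm_spec {D : V} (a : 𝟭 V ⟶ tensorRight D) (X : V) :
    K.coact X ≫ X ◁ (K.sigma₁ D).symm a = a.app X :=
  NatTrans.congr_app ((K.sigma₁ D).apply_symm_apply a) X

lemma curry_eq {X W Z : V} (b : X ⊗ W ⟶ Z) : tensorRightHomEquiv X W Wᘁ Z b =
    (ρ_ X).inv ≫ X ◁ η_ W Wᘁ ≫ (α_ X W Wᘁ).inv ≫ b ▷ Wᘁ := rfl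

lemma curry_nat {X Y W Z : V} (f : X ⟶ Y) (b : Y ⊗ W ⟶ Z) :
    tensorRightHomEquiv X W Wᘁ Z (f ▷ W ≫ b) = f ≫ tensorRightHomEquiv Y W Wᘁ Z b := by
  rw [curry_eq, curry_eq]
  calc _ = 𝟙 _ ⊗≫ (X ◁ η_ W Wᘁ ≫ f ▷ (W ⊗ Wᘁ)) ⊗≫ b ▷ Wᘁ := by monoidal
    _ = _ := by rw [whisker_exchange]; monoidal

lemma curry_coact {W D : V} (X : V) (f : K.C ⊗ W ⟶ D) :
    tensorRightHomEquiv X W Wᘁ (X ⊗ D) (K.coact X ▷ W ≫ (α_ X K.C W).hom ≫ X ◁ f) ≫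
      (α_ X D Wᘁ).hom = K.coact X ≫ X ◁ tensorRightHomEquiv K.C W Wᘁ D f := by
  rw [curry_nat, curry_eq, curry_eq]
  monoidal

/-- The parametrized version of `sigma₁`: a natural transformation `X ⊗ W ⟶ X ⊗ D`
factors through a morphism `C ⊗ W ⟶ D`. -/
def lift {W D : V} (a : tensorRight W ⟶ tensorRight D) : K.C ⊗ W ⟶ D :=
  (tensorRightHomEquiv K.C W Wᘁ D).symm ((K.sigma₁ (D ⊗ Wᘁ)).symm
    { app := fun X => tensorRightHomEquiv X W Wᘁ (X ⊗ D) (a.app X) ≫ (α_ X D Wᘁ).hom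
      naturality := fun X Y f => by
        have n : f ▷ W ≫ a.app Y = a.app X ≫ f ▷ D := a.naturality f
        change f ≫ _ = _ ≫ f ▷ (D ⊗ Wᘁ)
        rw [← Category.assoc, ← curry_nat, n, Category.assoc, ← associator_naturality_left,
          ← Category.assoc, ← tensorRightHomEquiv_naturality] })

lemma lift_spec {W D : V} (a : tensorRight W ⟶ tensorRight D) (X : V) :
    K.coact X ▷ W ≫ (α_ X K.C W).hom ≫ X ◁ K.lift a = a.app X := by
  apply (tensorRightHomEquiv X W Wᘁ (X ⊗ D)).injective
  rw [← cancel_mono (α_ X D Wᘁ).hom]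
  refine (K.curry_coact X (K.lift a)).trans ?_
  rw [lift, Equiv.apply_symm_apply, sigma₁_symm_spec]

lemma hom_ext_lift {W D : V} {f g : K.C ⊗ W ⟶ D}
    (h : ∀ X, K.coact X ▷ W ≫ (α_ X K.C W).hom ≫ X ◁ f =
      K.coact X ▷ W ≫ (α_ X K.C W).hom ≫ X ◁ g) : f = g := by
  apply (tensorRightHomEquiv K.C W Wᘁ D).injective
  apply K.hom_ext_coact
  intro X
  rw [← curry_coact, ← curry_coact, h]

lemma lift_precomp {W W' D D' : V} (a : tensorRight W ⟶ tensorRight D)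
    (a' : tensorRight W' ⟶ tensorRight D') (u : W ⟶ W') (w : D ⟶ D')
    (h : ∀ X : V, X ◁ u ≫ a'.app X = a.app X ≫ X ◁ w) :
    K.C ◁ u ≫ K.lift a' = K.lift a ≫ w := by
  apply K.hom_ext_lift
  intro X
  have e : K.coact X ▷ W ≫ (α_ X K.C W).hom ≫ X ◁ K.C ◁ u =
      X ◁ u ≫ K.coact X ▷ W' ≫ (α_ X K.C W').hom := by
    rw [whisker_exchange_assoc]; monoidal
  simp only [whiskerLeft_comp]
  rw [reassoc_of% e, lift_spec, h, ← K.lift_spec a]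
  simp only [Category.assoc]

section Two
variable [BraidedCategory V]

/-- `X ⊗ Y ⟶ (X ⊗ Y) ⊗ (C ⊗ C)`: coact on both factors and move the first copy of `C`
over `Y` by the braiding. -/
def coact₂ (X Y : V) : X ⊗ Y ⟶ (X ⊗ Y) ⊗ (K.C ⊗ K.C) :=
  (K.coact X ⊗ₘ K.coact Y) ≫ tensorμ X K.C Y K.C

lemma coact₂_naturality {X Y X' Y' : V} (f : X ⟶ X') (g : Y ⟶ Y') :
    (f ⊗ₘ g) ≫ K.coact₂ X' Y' = K.coact₂ X Y ≫ (f ⊗ₘ g) ▷ (K.C ⊗ K.C) := by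
  have h := tensorμ_natural f (𝟙 K.C) g (𝟙 K.C)
  simp only [tensorHom_id, MonoidalCategory.id_whiskerRight] at h
  rw [coact₂, coact₂, Category.assoc, ← h, ← Category.assoc, ← Category.assoc,
    tensorHom_comp_tensorHom, tensorHom_comp_tensorHom, coact_naturality, coact_naturality]

lemma coact₂_comp (X Y : V) {D : V} (f : K.C ⊗ K.C ⟶ D) :
    K.coact₂ X Y ≫ (X ⊗ Y) ◁ f ≫ (α_ X Y D).hom =
      K.coact X ▷ Y ≫ (α_ X K.C Y).hom ≫ X ◁ ((β_ K.C Y).hom ≫ K.coact Y ▷ K.C ≫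
        (α_ Y K.C K.C).hom ≫ Y ◁ ((β_ K.C K.C).inv ≫ f)) := by
  have h : K.C ◁ K.coact Y ≫ (α_ K.C Y K.C).inv ≫ (β_ K.C Y).hom ▷ K.C ≫ (α_ Y K.C K.C).hom =
      (β_ K.C Y).hom ≫ K.coact Y ▷ K.C ≫ (α_ Y K.C K.C).hom ≫ Y ◁ (β_ K.C K.C).inv := by
    have n := braiding_naturality_right K.C (K.coact Y)
    rw [← cancel_mono (Y ◁ (β_ K.C K.C).hom ≫ (α_ Y K.C K.C).inv)]
    rw [braiding_tensor_right_hom] at n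
    simp only [Category.assoc] at n ⊢
    rw [n]
    simp [← whiskerLeft_comp_assoc]
  calc _ = K.coact X ▷ Y ⊗≫ X ◁ (K.C ◁ K.coact Y ≫ (α_ K.C Y K.C).inv ≫
        (β_ K.C Y).hom ▷ K.C ≫ (α_ Y K.C K.C).hom) ⊗≫ X ◁ Y ◁ f := by
        rw [coact₂, tensorμ, MonoidalCategory.tensorHom_def]; monoidal
    _ = _ := by rw [h]; monoidal

lemma hom_ext₂ {D : V} {f g : K.C ⊗ K.C ⟶ D}
    (h : ∀ X Y, K.coact₂ X Y ≫ (X ⊗ Y) ◁ f = K.coact₂ X Y ≫ (X ⊗ Y) ◁ g) : f = g := by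
  rw [← cancel_epi (β_ K.C K.C).inv]
  apply K.hom_ext_lift
  intro Y
  rw [← cancel_epi (β_ K.C Y).hom]
  apply K.hom_ext_lift
  intro X
  rw [← coact₂_comp, ← coact₂_comp, ← Category.assoc, h, Category.assoc]

/-- Factorization of a natural transformation `X ⊗ Y ⟶ (X ⊗ Y) ⊗ D` through `coact₂`. -/
def lift₂ {D : V} (a : tensor V ⟶ tensor V ⋙ tensorRight D) : K.C ⊗ K.C ⟶ D :=
  (β_ K.C K.C).hom ≫ K.lift (W := K.C)
    { app := fun Y => (β_ K.C Y).inv ≫ K.lift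
        { app := fun X => (a.app (X, Y) ≫ (α_ X Y D).hom : X ⊗ Y ⟶ X ⊗ Y ⊗ D)
          naturality := fun X X' f => by
            have n := a.naturality (X := (X, Y)) (Y := (X', Y)) (f, 𝟙 Y)
            change (f ⊗ₘ 𝟙 Y) ≫ a.app (X', Y) = a.app (X, Y) ≫ (f ⊗ₘ 𝟙 Y) ▷ D at n
            rw [tensorHom_id] at n
            change f ▷ Y ≫ a.app (X', Y) ≫ _ = (a.app (X, Y) ≫ _) ≫ f ▷ (Y ⊗ D)
            rw [← Category.assoc, n]
            simp }
      naturality := fun Y Y' g => by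
        change g ▷ K.C ≫ (β_ K.C Y').inv ≫ _ = ((β_ K.C Y).inv ≫ _) ≫ g ▷ D
        rw [braiding_inv_naturality_left_assoc, Category.assoc]
        congr 1
        apply K.lift_precomp
        intro X
        have n := a.naturality (X := (X, Y)) (Y := (X, Y')) (𝟙 X, g)
        change (𝟙 X ⊗ₘ g) ≫ a.app (X, Y') = a.app (X, Y) ≫ (𝟙 X ⊗ₘ g) ▷ D at n
        rw [id_tensorHom] at n
        change X ◁ g ≫ a.app (X, Y') ≫ _ = (a.app (X, Y) ≫ _) ≫ X ◁ g ▷ D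
        rw [← Category.assoc, n]
        simp }

lemma lift₂_spec {D : V} (a : tensor V ⟶ tensor V ⋙ tensorRight D) (X Y : V) :
    K.coact₂ X Y ≫ (X ⊗ Y) ◁ K.lift₂ a = a.app (X, Y) := by
  have e := K.coact₂_comp X Y (K.lift₂ a)
  rw [← cancel_mono (α_ X Y D).hom, Category.assoc, e, lift₂, Iso.inv_hom_id_assoc,
    lift_spec, Iso.hom_inv_id_assoc]
  exact K.lift_spec _ X

/-- The bijection `f ↦ (X ⊗ Y ⊗ f) β (δ_X ⊗ δ_Y)` between morphisms `C ⊗ C ⟶ D` and natural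
transformations `X ⊗ Y ⟶ X ⊗ Y ⊗ D`. -/
def sigma₂ (D : V) : (K.C ⊗ K.C ⟶ D) ≃ (tensor V ⟶ tensor V ⋙ tensorRight D) where
  toFun f :=
    { app := fun X => K.coact₂ X.1 X.2 ≫ (X.1 ⊗ X.2) ◁ f
      naturality := fun X Y g => by
        change (g.1 ⊗ₘ g.2) ≫ K.coact₂ Y.1 Y.2 ≫ (Y.1 ⊗ Y.2) ◁ f =
          (K.coact₂ X.1 X.2 ≫ (X.1 ⊗ X.2) ◁ f) ≫ (g.1 ⊗ₘ g.2) ▷ D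
        rw [← Category.assoc, coact₂_naturality, Category.assoc, Category.assoc, whisker_exchange] }
  invFun a := K.lift₂ a
  left_inv f := K.hom_ext₂ (fun X Y => K.lift₂_spec _ X Y)
  right_inv a := by
    ext ⟨X, Y⟩
    exact K.lift₂_spec a X Y
end Two

section Hopf
variable [BraidedCategory V]

/-- The coproduct of `C`: `(X ⊗ Δ) δ_X = (δ_X ⊗ C) δ_X`. -/
def comul : K.C ⟶ K.C ⊗ K.C :=
  (K.sigma₁ (K.C ⊗ K.C)).symm
    { app := fun X => K.coact X ≫ K.coact X ▷ K.C ≫ (α_ X K.C K.C).hom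
      naturality := fun X Y f => by
        change f ≫ K.coact Y ≫ _ = (K.coact X ≫ _) ≫ f ▷ (K.C ⊗ K.C)
        rw [← Category.assoc, coact_naturality, Category.assoc, ← comp_whiskerRight_assoc, coact_naturality]
        simp }

/-- The counit of `C`: `(X ⊗ ε) δ_X = X`. -/
def counit : K.C ⟶ 𝟙_ V :=
  (K.sigma₁ (𝟙_ V)).symm
    { app := fun X => (ρ_ X).inv
      naturality := fun _ _ f => (rightUnitor_inv_naturality f) }

/-- The unit of `C`: the coaction on the unit object. -/
def unit : 𝟙_ V ⟶ K.C := K.coact (𝟙_ V) ≫ (λ_ K.C).hom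

/-- The product of `C`: it computes the coaction on a tensor product. -/
def mul : K.C ⊗ K.C ⟶ K.C :=
  (K.sigma₂ K.C).symm
    { app := fun X => K.coact (X.1 ⊗ X.2)
      naturality := fun _ _ f => K.coact_naturality (f.1 ⊗ₘ f.2) }

/-- The canonical pairing `ω` of `C`: it computes the inverse of the double braiding. -/
def pairing : K.C ⊗ K.C ⟶ 𝟙_ V :=
  (K.sigma₂ (𝟙_ V)).symm
    { app := fun X => (β_ X.2 X.1).inv ≫ (β_ X.1 X.2).inv ≫ (ρ_ (X.1 ⊗ X.2)).inv
      naturality := fun X Y f => by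
        change (f.1 ⊗ₘ f.2) ≫ _ = _ ≫ (f.1 ⊗ₘ f.2) ▷ 𝟙_ V
        rw [braiding_inv_naturality_assoc, braiding_inv_naturality_assoc,
          rightUnitor_inv_naturality]
        simp only [Category.assoc] }

/-- The convolution inverse of `ω`: it computes the double braiding. -/
def pairingInv : K.C ⊗ K.C ⟶ 𝟙_ V :=
  (K.sigma₂ (𝟙_ V)).symm
    { app := fun X => (β_ X.1 X.2).hom ≫ (β_ X.2 X.1).hom ≫ (ρ_ (X.1 ⊗ X.2)).inv
      naturality := fun X Y f => by
        change (f.1 ⊗ₘ f.2) ≫ _ = _ ≫ (f.1 ⊗ₘ f.2) ▷ 𝟙_ V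
        rw [braiding_naturality_assoc, braiding_naturality_assoc,
          rightUnitor_inv_naturality]
        simp only [Category.assoc] }

/-- The map `X ⟶ X ⊗ C` obtained by coacting on the dual of `X` and bending the strands:
`X ⟶ X ⊗ ᘁX ⊗ X ⟶ X ⊗ ᘁX ⊗ C ⊗ X ⟶ C ⊗ X ⟶ X ⊗ C`. -/
def dualCoact (X : V) : X ⟶ X ⊗ K.C :=
  𝟙 X ⊗≫ X ◁ η_ (ᘁX : V) X ⊗≫ X ◁ K.coact (ᘁX : V) ▷ X ⊗≫ ε_ (ᘁX : V) X ▷ (K.C ⊗ X) ⊗≫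
    (β_ X K.C).inv

lemma dualCoact_naturality {X Y : V} (f : X ⟶ Y) :
    f ≫ K.dualCoact Y = K.dualCoact X ≫ f ▷ K.C := by
  have h1 : η_ (ᘁY : V) Y ≫ (ᘁf : (ᘁY : V) ⟶ (ᘁX : V)) ▷ Y = η_ (ᘁX : V) X ≫ (ᘁX : V) ◁ f :=
    coevaluation_comp_leftAdjointMate f
  have h2 : X ◁ (ᘁf : (ᘁY : V) ⟶ (ᘁX : V)) ≫ ε_ (ᘁX : V) X = f ▷ (ᘁY : V) ≫ ε_ (ᘁY : V) Y :=
    leftAdjointMate_comp_evaluation f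
  have n : (ᘁf : (ᘁY : V) ⟶ (ᘁX : V)) ≫ K.coact (ᘁX : V) =
      K.coact (ᘁY : V) ≫ (ᘁf : (ᘁY : V) ⟶ (ᘁX : V)) ▷ K.C := K.coact_naturality _
  calc _ = 𝟙 X ⊗≫ (f ▷ 𝟙_ V ≫ Y ◁ η_ (ᘁY : V) Y) ⊗≫ Y ◁ K.coact (ᘁY : V) ▷ Y ⊗≫
        ε_ (ᘁY : V) Y ▷ (K.C ⊗ Y) ⊗≫ (β_ Y K.C).inv := by
        rw [dualCoact]; monoidal
    _ = 𝟙 X ⊗≫ X ◁ η_ (ᘁY : V) Y ⊗≫ (f ▷ (ᘁY : V) ≫ Y ◁ K.coact (ᘁY : V)) ▷ Y ⊗≫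
        ε_ (ᘁY : V) Y ▷ (K.C ⊗ Y) ⊗≫ (β_ Y K.C).inv := by
        rw [← whisker_exchange]; monoidal
    _ = 𝟙 X ⊗≫ X ◁ η_ (ᘁY : V) Y ⊗≫ X ◁ K.coact (ᘁY : V) ▷ Y ⊗≫
        (f ▷ (ᘁY : V) ≫ ε_ (ᘁY : V) Y) ▷ (K.C ⊗ Y) ⊗≫ (β_ Y K.C).inv := by
        rw [← whisker_exchange]; monoidal
    _ = 𝟙 X ⊗≫ X ◁ η_ (ᘁY : V) Y ⊗≫
        X ◁ (K.coact (ᘁY : V) ≫ (ᘁf : (ᘁY : V) ⟶ (ᘁX : V)) ▷ K.C) ▷ Y ⊗≫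
        ε_ (ᘁX : V) X ▷ (K.C ⊗ Y) ⊗≫ (β_ Y K.C).inv := by
        rw [← h2]; monoidal
    _ = 𝟙 X ⊗≫ X ◁ (η_ (ᘁY : V) Y ≫ (ᘁf : (ᘁY : V) ⟶ (ᘁX : V)) ▷ Y) ⊗≫
        X ◁ K.coact (ᘁX : V) ▷ Y ⊗≫
        ε_ (ᘁX : V) X ▷ (K.C ⊗ Y) ⊗≫ (β_ Y K.C).inv := by
        rw [← n]; monoidal
    _ = 𝟙 X ⊗≫ X ◁ η_ (ᘁX : V) X ⊗≫ ((X ⊗ (ᘁX : V)) ◁ f ≫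
        (X ◁ K.coact (ᘁX : V)) ▷ Y) ⊗≫
        ε_ (ᘁX : V) X ▷ (K.C ⊗ Y) ⊗≫ (β_ Y K.C).inv := by
        rw [h1]; monoidal
    _ = 𝟙 X ⊗≫ X ◁ η_ (ᘁX : V) X ⊗≫ (X ◁ K.coact (ᘁX : V)) ▷ X ⊗≫
        ((X ⊗ (ᘁX : V)) ◁ K.C ◁ f ≫ ε_ (ᘁX : V) X ▷ (K.C ⊗ Y)) ⊗≫ (β_ Y K.C).inv := by
        rw [whisker_exchange]; monoidal
    _ = 𝟙 X ⊗≫ X ◁ η_ (ᘁX : V) X ⊗≫ (X ◁ K.coact (ᘁX : V)) ▷ X ⊗≫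
        ε_ (ᘁX : V) X ▷ (K.C ⊗ X) ⊗≫ (K.C ◁ f ≫ (β_ Y K.C).inv) := by
        rw [whisker_exchange]; monoidal
    _ = _ := by
        rw [braiding_inv_naturality_right, dualCoact]; monoidal

/-- The antipode of `C`. -/
def antipode : K.C ⟶ K.C :=
  (K.sigma₁ K.C).symm
    { app := fun X => K.dualCoact X
      naturality := fun _ _ f => K.dualCoact_naturality f }

/-- The coproduct of the braided tensor coalgebra `C ⊗ C`. -/
def comul₂ : K.C ⊗ K.C ⟶ (K.C ⊗ K.C) ⊗ (K.C ⊗ K.C) :=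
  (K.comul ⊗ₘ K.comul) ≫ tensorμ K.C K.C K.C K.C

/-- The endomorphism `E` of `C ⊗ C` that exchanges the two coactions when `X` and `Y` are exchanged
by the braiding: `X ⊗ Y ⟶ Y ⊗ X ⟶ (Y ⊗ X) ⊗ (C ⊗ C) ⟶ (X ⊗ Y) ⊗ (C ⊗ C)`, given by `β_ X Y`, the
coactions of `Y` and `X`, and `β_ Y X`, equals the coactions of `X` and `Y` followed by `E`. -/
def exchange : K.C ⊗ K.C ⟶ K.C ⊗ K.C :=
  (K.comul ⊗ₘ K.comul) ⊗≫ (β_ (K.C ⊗ K.C) K.C).hom ▷ K.C ⊗≫ K.C ◁ K.C ◁ (β_ K.C K.C).hom ⊗≫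
    K.C ◁ K.pairingInv ▷ K.C ⊗≫ 𝟙 (K.C ⊗ K.C)

/-- The endomorphism of `C ⊗ C` that turns `coact₂ X Y` into the separate coactions
on `X` and on `Y`, followed by the inverse braiding of `Y` and `C`. -/
def separate : K.C ⊗ K.C ⟶ K.C ⊗ K.C :=
  (K.coact K.C ⊗ₘ K.comul) ⊗≫ K.C ◁ K.pairing ▷ K.C ⊗≫ 𝟙 (K.C ⊗ K.C)

end Hopf
end CoendData
end Coend

section Elements
variable {V : Type u} [Category.{v} V] [MonoidalCategory V] [BraidedCategory V] [RigidCategory V]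

/-- The product of the braided tensor algebra `H ⊗ H`. -/
def mul₂ (H : V) [MonObj H] : (H ⊗ H) ⊗ (H ⊗ H) ⟶ H ⊗ H :=
  tensorμ H H H H ≫ (μ[H] ⊗ₘ μ[H])

/-- An `R`-matrix `C ⊗ C ⟶ H ⊗ H` for a bialgebra `H`. The axioms express, in terms of `hom`, that
the morphisms `σ_{M, N}` defined from `hom` in `RMatrix.braid` below are `H`-linear, satisfy the two
hexagons, and are the identity when `M` or `N` is the unit module. When `V` is the category of
vector spaces, `C` is the ground field and they are the usual axioms of an `R`-matrix in `H ⊗ H`. -/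
structure RMatrix (K : CoendData V) (H : V) [BimonObj H] where
  hom : K.C ⊗ K.C ⟶ H ⊗ H
  /-- Linearity: it generalizes `R Δ(h) = Δᵒᵖ(h) R`. -/
  intertwine : (hom ⊗ₘ Δ[H]) ≫ mul₂ H =
    (K.C ⊗ K.C) ◁ Δ[H] ⊗≫ (K.C ⊗ K.C) ◁ (K.coact H ⊗ₘ K.coact H) ⊗≫
      (β_ (K.C ⊗ K.C) H).hom ▷ (K.C ⊗ H ⊗ K.C) ⊗≫ H ◁ K.C ◁ K.exchange ▷ (H ⊗ K.C) ⊗≫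
      H ◁ (β_ (K.C ⊗ K.C ⊗ K.C) H).hom ▷ K.C ⊗≫ (H ⊗ H) ◁ (K.mul ⊗ₘ K.mul) ⊗≫
      (H ⊗ H) ◁ hom ⊗≫ (β_ H (H ⊗ H)).hom ▷ H ⊗≫ (μ[H] ⊗ₘ μ[H])
  /-- The hexagon for the braiding of `M ⊗ N` with `P`: it generalizes
  `(H ⊗ Δ) R = R₁₃ R₁₂`. -/
  comul_right : K.mul ▷ K.C ≫ hom ≫ H ◁ Δ[H] =
    ((K.coact K.C ⊗ₘ K.comul) ⊗ₘ K.comul) ⊗≫ K.C ◁ K.pairing ▷ (K.C ⊗ K.C ⊗ K.C) ⊗≫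
      K.C ◁ (β_ K.C K.C).hom ▷ K.C ⊗≫ (K.C ⊗ K.C) ◁ hom ⊗≫ (K.C ⊗ K.C) ◁ K.coact H ▷ H ⊗≫
      (β_ (K.C ⊗ K.C) H).hom ▷ (K.C ⊗ H) ⊗≫ H ◁ K.C ◁ K.mul ▷ H ⊗≫ H ◁ hom ▷ H ⊗≫
      μ[H] ▷ (H ⊗ H) ⊗≫ 𝟙 (H ⊗ (H ⊗ H))
  /-- The hexagon for the braiding of `M` with `N ⊗ P`: it generalizes
  `(Δ ⊗ H) R = R₁₃ R₂₃`. -/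
  comul_left : K.C ◁ K.mul ≫ hom ≫ Δ[H] ▷ H =
    K.comul ▷ (K.C ⊗ K.C) ⊗≫ K.C ◁ hom ▷ K.C ⊗≫ (β_ K.C H).hom ▷ (H ⊗ K.C) ⊗≫
      (H ⊗ K.C) ◁ K.coact H ▷ K.C ⊗≫ H ◁ (β_ K.C H).hom ▷ (K.C ⊗ K.C) ⊗≫
      (H ⊗ H) ◁ K.mul ▷ K.C ⊗≫ (K.coact H ▷ (H ⊗ K.C)) ▷ K.C ⊗≫
      (H ⊗ K.C ⊗ H ⊗ K.C) ◁ K.comul ⊗≫ (H ⊗ K.C) ◁ (β_ (H ⊗ K.C) K.C).hom ▷ K.C ⊗≫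
      H ◁ K.pairing ▷ (H ⊗ K.C ⊗ K.C) ⊗≫ (H ⊗ H) ◁ hom ⊗≫ H ◁ (β_ H H).hom ▷ H ⊗≫
      (H ⊗ H) ◁ μ[H]
  /-- Normalization: the braiding with the unit module on the right. -/
  counit_left : (ρ_ K.C).inv ≫ K.C ◁ K.unit ≫ hom ≫ ε[H] ▷ H ≫ (λ_ H).hom = K.counit ≫ η[H]
  /-- Normalization: the braiding with the unit module on the left. -/
  counit_right : (λ_ K.C).inv ≫ K.unit ▷ K.C ≫ hom ≫ H ◁ ε[H] ≫ (ρ_ H).hom = K.counit ≫ η[H]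

/-- The bijection between `C`-elements and natural families `X ⟶ X ⊗ H`, evaluated on a module
and followed by the action: the endomorphism `r (M ⊗ a) δ_M` of the object underlying `M`. -/
def elementAct {K : CoendData V} {H : V} [MonObj H] (a : K.C ⟶ H) (M : RMod H) : M.X ⟶ M.X :=
  K.coact M.X ≫ M.X ◁ a ≫ M.act

/-- A `C`-element is central if left and right multiplication by it agree. -/
def IsCentralElement {K : CoendData V} {H : V} [MonObj H] (a : K.C ⟶ H) : Prop :=
  a ▷ H ≫ μ[H] = K.C ◁ K.coact H ⊗≫ (β_ K.C H).hom ▷ K.C ⊗≫ H ◁ (K.mul ≫ a) ≫ μ[H]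

namespace RMatrix
variable {K : CoendData V} {H : V} [BimonObj H] (R : RMatrix K H)

/-- The lax braiding on right `H`-modules (as a morphism of `V`) induced by an `R`-matrix `R`:
coact on both factors, apply `R`, move `M` over `N ⊗ H`, and act by the first output
on `N` and by the second output on `M`. -/
def braid (M N : RMod H) : M.X ⊗ N.X ⟶ N.X ⊗ M.X :=
  K.coact₂ M.X N.X ≫ (M.X ⊗ N.X) ◁ R.hom ⊗≫ (β_ M.X (N.X ⊗ H)).hom ▷ H ⊗≫ (N.act ⊗ₘ M.act)

/-- A balanced structure on the category of right `H`-modules with the lax braiding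
induced by `R`: a natural endomorphism `θ` of the identity functor such that
`θ_{M ⊗ N} = (θ_M ⊗ θ_N) σ_{N, M} σ_{M, N}` and `θ_𝟙 = id`. -/
@[ext]
structure BalancedStructure where
  θ : 𝟭 (RMod H) ⟶ 𝟭 (RMod H)
  tensor (M N : RMod H) : (θ.app (M ⊗ N)).hom =
    R.braid M N ≫ R.braid N M ≫ ((θ.app M).hom ⊗ₘ (θ.app N).hom)
  unit : θ.app (𝟙_ (RMod H)) = 𝟙 (𝟙_ (RMod H))

/-- The morphism `C ⊗ C ⟶ H ⊗ H` that represents the double braiding `σ_{N, M} σ_{M, N}`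
of modules (it generalizes `R₂₁ R`): with `Q` this morphism, the double braiding is `coact₂ M N`
followed by `Q`, by moving `N` over the first output, and by acting. -/
def doubleBraid : K.C ⊗ K.C ⟶ H ⊗ H :=
  K.comul₂ ⊗≫ (K.C ⊗ K.C) ◁ R.hom ⊗≫ (K.C ⊗ K.C) ◁ (K.coact H ⊗ₘ K.coact H) ⊗≫
    (β_ (K.C ⊗ K.C) H).hom ▷ (K.C ⊗ H ⊗ K.C) ⊗≫ H ◁ K.C ◁ K.mul ▷ (H ⊗ K.C) ⊗≫
    H ◁ K.exchange ▷ (H ⊗ K.C) ⊗≫ H ◁ (β_ (K.C ⊗ K.C) H).hom ▷ K.C ⊗≫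
    (H ⊗ H ⊗ K.C) ◁ K.mul ⊗≫ (H ⊗ H) ◁ R.hom ⊗≫ (β_ H (H ⊗ H)).hom ▷ H ⊗≫ (μ[H] ⊗ₘ μ[H])

/-- `C`-balanced elements. -/
structure IsBalancedElement (t : K.C ⟶ H) : Prop where
  central : IsCentralElement t
  counit : K.unit ≫ t ≫ ε[H] = 𝟙 (𝟙_ V)
  twist : K.mul ≫ t ≫ Δ[H] =
    K.comul₂ ≫ ((K.separate ≫ (t ⊗ₘ t)) ⊗ₘ R.doubleBraid) ≫ mul₂ H

end RMatrix

open ExactPairing in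
/-- The operation `S` on `C`-elements of a Hopf algebra `H`. -/
def elementAntipode {K : CoendData V} {H : V} [HopfObj H] (a : K.C ⟶ H) : K.C ⟶ H :=
  𝟙 K.C ⊗≫ K.C ◁ η_ (ᘁH : V) H ⊗≫ K.C ◁ (ᘁH : V) ◁ K.coact H ⊗≫
    (β_ K.C ((ᘁH : V) ⊗ H)).hom ▷ K.C ⊗≫ ((ᘁH : V) ⊗ H) ◁ (K.mul ≫ K.antipode) ⊗≫
    (β_ ((ᘁH : V) ⊗ H) K.C).hom ⊗≫ (a ≫ 𝒮[H]) ▷ ((ᘁH : V) ⊗ H) ⊗≫ ε_ (ᘁH : V) H ▷ H ⊗≫ 𝟙 H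

namespace RMatrix
variable {K : CoendData V} {H : V} [HopfObj H] (R : RMatrix K H)

/-- `C`-ribbon elements. -/
structure IsRibbonElement (t : K.C ⟶ H) : Prop extends R.IsBalancedElement t where
  antipode : elementAntipode t = t

/-- A balanced structure is ribbon if `θ = θ^!`, where `θ^!_M` is the dual morphism of
`θ_{ᘁM}`. -/
def BalancedStructure.IsRibbon {R : RMatrix K H} (b : R.BalancedStructure) : Prop :=
  ∀ M : RMod H, rightAdjointMate (X := (ᘁM : RMod H)) (Y := (ᘁM : RMod H)) (b.θ.app (ᘁM : RMod H)) = b.θ.app M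

end RMatrix
end Elements

end

/-! The proof is reconstruction from actions. Every module is a quotient of a free module X ⊗ H, so
a natural endomorphism of the identity of the module category is determined by its values on the
generators X → X ⊗ H (`elementAct_elementOf`). These values form a natural family, hence a morphism
C → H by the universal property of the coend. Conversely, t : C → H acts on the object underlying
any module, naturally in module maps, and it acts H-linearly exactly when t is central
(`isCentralElement_iff`). In two variables, a morphism C ⊗ C → H ⊗ H is determined by its action
`pairAct` on all M ⊗ N (`pairAct_injective`).

The axioms are then translated one by one. The condition θ_𝟙 = id is (CT2), by `elementAct_unit`. In
(CT3) the left side acts as θ_{M ⊗ N} (`elementAct_tensor`), (t ⊗ t)G acts as θ_M ⊗ θ_N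
(`elementAct_tensorHom`), Q acts as the double braiding (`RMatrix.braid_braid`, which rests on
`CoendData.coact₂_exchange`), and the convolution product acts as composition (`pairAct_mul₂`). The
convolution applies t ⊗ t before Q, the balancing axiom after the double braiding; centrality of t
makes the two commute.

For (CT4), S(t) acts on M as the dual morphism of the action of t on the dual module
(`elementAct_dual`). Since an element is determined by its action, θ = θ^! becomes S(t) = t. -/

/-! ### Graphical identities for the universal coaction -/

section CoactionIdentities
variable {V : Type u} [Category.{v} V] [MonoidalCategory V] [BraidedCategory V] [RigidCategory V]

omit [RigidCategory V] in
lemma tensorμ_comp_whiskerLeft (X Y : V) {A B A' B' : V} (f : A ⟶ A') (g : B ⟶ B') :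
    tensorμ X A Y B ≫ (X ⊗ Y) ◁ (f ⊗ₘ g) = (X ◁ f ⊗ₘ Y ◁ g) ≫ tensorμ X A' Y B' := by
  simpa using (tensorμ_natural (𝟙 X) f (𝟙 Y) g).symm

omit [RigidCategory V] in
lemma tensorμ_comp_whiskerRight (A B : V) {X Y X' Y' : V} (f : X ⟶ X') (g : Y ⟶ Y') :
    tensorμ X A Y B ≫ (f ⊗ₘ g) ▷ (A ⊗ B) = (f ▷ A ⊗ₘ g ▷ B) ≫ tensorμ X' A Y' B := by
  simpa using (tensorμ_natural f (𝟙 A) g (𝟙 B)).symm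

namespace CoendData
variable (K : CoendData V)

-- This equation and the four after it restate the universal properties that define the structure
-- maps of C; coproduct, antipode, product and pairings enter the later arguments through them.
omit [BraidedCategory V] in
lemma coact_comul (X : V) :
    K.coact X ≫ X ◁ K.comul = K.coact X ≫ K.coact X ▷ K.C ≫ (α_ X K.C K.C).hom :=
  K.sigma₁_symm_spec _ X

lemma coact_antipode (X : V) : K.coact X ≫ X ◁ K.antipode = K.dualCoact X :=
  K.sigma₁_symm_spec _ X

lemma coact₂_mul (X Y : V) : K.coact₂ X Y ≫ (X ⊗ Y) ◁ K.mul = K.coact (X ⊗ Y) :=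
  K.lift₂_spec _ X Y

lemma coact₂_pairing (X Y : V) : K.coact₂ X Y ≫ (X ⊗ Y) ◁ K.pairing =
    (β_ Y X).inv ≫ (β_ X Y).inv ≫ (ρ_ (X ⊗ Y)).inv :=
  K.lift₂_spec _ X Y

lemma coact₂_pairingInv (X Y : V) : K.coact₂ X Y ≫ (X ⊗ Y) ◁ K.pairingInv =
    (β_ X Y).hom ≫ (β_ Y X).hom ≫ (ρ_ (X ⊗ Y)).inv :=
  K.lift₂_spec _ X Y

/-- The two coactions act on different strands, so either may come first. Both orders are recorded
because a graphical argument needs a chosen one at the top. -/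
lemma coact₂_eq (X Y : V) : K.coact₂ X Y =
    K.coact X ▷ Y ⊗≫ X ◁ K.C ◁ K.coact Y ⊗≫ X ◁ (β_ K.C Y).hom ▷ K.C ⊗≫
      𝟙 ((X ⊗ Y) ⊗ K.C ⊗ K.C) := by
  rw [coact₂, tensorμ, MonoidalCategory.tensorHom_def]; monoidal

lemma coact₂_eq' (X Y : V) : K.coact₂ X Y =
    X ◁ K.coact Y ⊗≫ K.coact X ▷ (Y ⊗ K.C) ⊗≫ X ◁ (β_ K.C Y).hom ▷ K.C ⊗≫
      𝟙 ((X ⊗ Y) ⊗ K.C ⊗ K.C) := by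
  rw [coact₂, tensorμ, MonoidalCategory.tensorHom_def']; monoidal

/-- `C ⊗ C` is a coalgebra that coacts on tensor products. -/
lemma coact₂_comul₂ (X Y : V) : K.coact₂ X Y ≫ (X ⊗ Y) ◁ K.comul₂ =
    K.coact₂ X Y ≫ K.coact₂ X Y ▷ (K.C ⊗ K.C) ≫ (α_ (X ⊗ Y) (K.C ⊗ K.C) (K.C ⊗ K.C)).hom := by
  have h := associator_monoidal X K.C K.C Y K.C K.C
  have l := tensorμ_comp_whiskerLeft X Y K.comul K.comul
  have r := tensorμ_comp_whiskerRight K.C K.C (K.coact X) (K.coact Y)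
  rw [comul₂, whiskerLeft_comp, coact₂]
  simp only [Category.assoc, comp_whiskerRight]
  rw [reassoc_of% l, reassoc_of% r, h,
    tensorHom_comp_tensorHom_assoc, tensorHom_comp_tensorHom_assoc, tensorHom_comp_tensorHom_assoc,
    coact_comul, coact_comul, Category.assoc, Category.assoc]

/-- Braiding past a coaction. -/
lemma coact_braiding (X Y : V) : K.coact X ▷ Y ⊗≫ X ◁ (β_ K.C Y).hom ⊗≫ (β_ X Y).hom ▷ K.C =
    ((β_ X Y).hom ≫ Y ◁ K.coact X) ⊗≫ 𝟙 ((Y ⊗ X) ⊗ K.C) := by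
  rw [← braiding_naturality_left, braiding_tensor_left_hom]
  monoidal

lemma braiding_coact (X Y : V) : X ◁ K.coact Y ⊗≫ (β_ X Y).hom ▷ K.C ⊗≫ Y ◁ (β_ X K.C).hom =
    ((β_ X Y).hom ≫ K.coact Y ▷ X) ⊗≫ 𝟙 (Y ⊗ K.C ⊗ X) := by
  rw [← braiding_naturality_right, braiding_tensor_right_hom]
  monoidal

/-- Inserting `pairing` between two braided strands inserts an inverse double braiding, which turns
the positive crossing of Z and Y into the negative one; the last crossing then cancels it. -/
lemma braiding_coact_braiding (Z Y : V) : 𝟙 (Z ⊗ Y) ⊗≫ Z ◁ K.coact Y ⊗≫ (β_ Z Y).hom ▷ K.C ⊗≫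
    Y ◁ K.coact Z ▷ K.C ⊗≫
      Y ◁ Z ◁ K.pairing ⊗≫ (β_ Y Z).hom = 𝟙 (Z ⊗ Y) := by
  calc _ = 𝟙 (Z ⊗ Y) ⊗≫ Z ◁ K.coact Y ⊗≫ (((β_ Z Y).hom ≫ Y ◁ K.coact Z) ⊗≫
           𝟙 ((Y ⊗ Z) ⊗ K.C)) ▷ K.C ⊗≫
      Y ◁ Z ◁ K.pairing ⊗≫ (β_ Y Z).hom := by monoidal
    _ = K.coact₂ Z Y ⊗≫ ((β_ Z Y).hom ▷ (K.C ⊗ K.C) ≫ (Y ⊗ Z) ◁ K.pairing) ⊗≫ (β_ Y Z).hom := by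
      rw [← coact_braiding, coact₂_eq']; monoidal
    _ = (K.coact₂ Z Y ≫ (Z ⊗ Y) ◁ K.pairing) ⊗≫ (β_ Z Y).hom ⊗≫ (β_ Y Z).hom := by
      rw [← whisker_exchange]; monoidal
    _ = (β_ Y Z).inv ≫ (β_ Z Y).inv ≫ (β_ Z Y).hom ≫ (β_ Y Z).hom := by
      rw [coact₂_pairing]; monoidal
    _ = _ := by simp

/-- After `separate`, `coact₂` becomes the tensor product of the two coactions. -/
lemma coact₂_separate (X Y : V) : K.coact₂ X Y ≫ (X ⊗ Y) ◁ K.separate ≫ tensorμ X Y K.C K.C =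
    K.coact X ⊗ₘ K.coact Y := by
  calc _ = K.coact X ▷ Y ⊗≫ X ◁ (K.C ◁ K.coact Y ⊗≫ ((β_ K.C Y).hom ▷ K.C ≫ (Y ⊗ K.C) ◁ K.comul) ⊗≫
        Y ◁ K.coact K.C ▷ (K.C ⊗ K.C) ⊗≫ Y ◁ K.C ◁ K.pairing ▷ K.C ⊗≫ (β_ Y K.C).hom ▷ K.C) ⊗≫
        𝟙 ((X ⊗ K.C) ⊗ (Y ⊗ K.C)) := by
        rw [coact₂_eq, separate, tensorμ, MonoidalCategory.tensorHom_def']; monoidal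
    _ = K.coact X ▷ Y ⊗≫ X ◁ (K.C ◁ (K.coact Y ≫ Y ◁ K.comul) ⊗≫ (β_ K.C Y).hom ▷ (K.C ⊗ K.C) ⊗≫
        Y ◁ K.coact K.C ▷ (K.C ⊗ K.C) ⊗≫ Y ◁ K.C ◁ K.pairing ▷ K.C ⊗≫ (β_ Y K.C).hom ▷ K.C) ⊗≫
        𝟙 ((X ⊗ K.C) ⊗ (Y ⊗ K.C)) := by
        rw [← whisker_exchange]; monoidal
    -- The coproduct on the leg of Y becomes a second coaction of Y. The inner bracket is then
    -- `braiding_coact_braiding` with Z = C, and the outer coaction survives as the final leg of Y.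
    _ = K.coact X ▷ Y ⊗≫ X ◁ (K.C ◁ K.coact Y ⊗≫ (𝟙 (K.C ⊗ Y) ⊗≫ K.C ◁ K.coact Y ⊗≫
        (β_ K.C Y).hom ▷ K.C ⊗≫
        Y ◁ K.coact K.C ▷ K.C ⊗≫ Y ◁ K.C ◁ K.pairing ⊗≫ (β_ Y K.C).hom) ▷ K.C) ⊗≫
        𝟙 ((X ⊗ K.C) ⊗ (Y ⊗ K.C)) := by
        rw [coact_comul]; monoidal
    _ = _ := by
        rw [braiding_coact_braiding, MonoidalCategory.tensorHom_def]; monoidal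

/-- Exchanging two coactions by the braidings. -/
lemma coact₂_exchange (X Y : V) : K.coact₂ X Y ≫ (X ⊗ Y) ◁ K.exchange =
    (β_ X Y).hom ≫ K.coact₂ Y X ≫ (β_ Y X).hom ▷ (K.C ⊗ K.C) := by
  -- Pulling the coaction of X above both crossings and that of Y below them leaves a bare double
  -- braiding in the middle, which is what `pairingInv` computes.
  have r : (β_ X Y).hom ≫ K.coact₂ Y X ≫ (β_ Y X).hom ▷ (K.C ⊗ K.C) =
      K.coact X ▷ Y ⊗≫ X ◁ (β_ K.C Y).hom ⊗≫ ((β_ X Y).hom ≫ (β_ Y X).hom ≫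
      (ρ_ (X ⊗ Y)).inv) ▷ K.C ⊗≫
        X ◁ K.coact Y ▷ K.C ⊗≫ 𝟙 ((X ⊗ Y) ⊗ K.C ⊗ K.C) := by
    calc _ = (((β_ X Y).hom ≫ Y ◁ K.coact X) ⊗≫ 𝟙 ((Y ⊗ X) ⊗ K.C)) ⊗≫
          (K.coact Y ▷ X ⊗≫ Y ◁ (β_ K.C X).hom ⊗≫ (β_ Y X).hom ▷ K.C) ▷ K.C ⊗≫
          𝟙 ((X ⊗ Y) ⊗ K.C ⊗ K.C) := by
          rw [coact₂_eq']; monoidal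
      _ = _ := by
          rw [← coact_braiding K X Y, coact_braiding K Y X]; monoidal
  have e : K.coact₂ X Y ≫ (X ⊗ Y) ◁ (K.comul ⊗ₘ K.comul) =
      K.coact X ▷ Y ⊗≫ K.coact X ▷ K.C ▷ Y ⊗≫ X ◁ (K.C ⊗ K.C) ◁ K.coact Y ⊗≫
        X ◁ ((K.C ⊗ K.C) ◁ K.coact Y ⊗≫ (β_ (K.C ⊗ K.C) Y).hom ▷ K.C) ▷ K.C ⊗≫
        𝟙 ((X ⊗ Y) ⊗ (K.C ⊗ K.C) ⊗ K.C ⊗ K.C) := by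
    rw [coact₂, Category.assoc, tensorμ_comp_whiskerLeft, tensorHom_comp_tensorHom_assoc,
      coact_comul, coact_comul, tensorμ, MonoidalCategory.tensorHom_def]
    monoidal
  rw [r, ← coact₂_pairingInv]
  calc _ = (K.coact₂ X Y ≫ (X ⊗ Y) ◁ (K.comul ⊗ₘ K.comul)) ⊗≫
          X ◁ Y ◁ (β_ (K.C ⊗ K.C) K.C).hom ▷ K.C ⊗≫
          X ◁ Y ◁ K.C ◁ K.C ◁ (β_ K.C K.C).hom ⊗≫ X ◁ Y ◁ K.C ◁ K.pairingInv ▷ K.C ⊗≫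
          𝟙 ((X ⊗ Y) ⊗ K.C ⊗ K.C) := by
          rw [exchange]; monoidal
    _ = K.coact X ▷ Y ⊗≫ K.coact X ▷ K.C ▷ Y ⊗≫ X ◁ (K.C ⊗ K.C) ◁ K.coact Y ⊗≫
          X ◁ ((K.C ⊗ K.C) ◁ K.coact Y ≫ (β_ (K.C ⊗ K.C) (Y ⊗ K.C)).hom) ▷ K.C ⊗≫
          X ◁ Y ◁ K.C ◁ K.C ◁ (β_ K.C K.C).hom ⊗≫ X ◁ Y ◁ K.C ◁ K.pairingInv ▷ K.C ⊗≫
          𝟙 ((X ⊗ Y) ⊗ K.C ⊗ K.C) := by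
          rw [e, braiding_tensor_right_hom]; monoidal
    -- The second coaction of Y slides below the block C ⊗ C, so that it can be performed last, as
    -- in `r`.
    _ = K.coact X ▷ Y ⊗≫ K.coact X ▷ K.C ▷ Y ⊗≫ X ◁ (K.C ⊗ K.C) ◁ K.coact Y ⊗≫
          X ◁ (β_ (K.C ⊗ K.C) Y).hom ▷ K.C ⊗≫ (X ◁ (K.coact Y ▷ ((K.C ⊗ K.C) ⊗ K.C) ≫
          (Y ⊗ K.C) ◁ ((α_ _ _ _).hom ≫ K.C ◁ (β_ K.C K.C).hom ≫ (α_ _ _ _).inv ≫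
          K.pairingInv ▷ K.C))) ⊗≫
          𝟙 ((X ⊗ Y) ⊗ K.C ⊗ K.C) := by
          rw [braiding_naturality_right]; monoidal
    _ = K.coact X ▷ Y ⊗≫ K.coact X ▷ K.C ▷ Y ⊗≫
          X ◁ K.C ◁ (K.C ◁ K.coact Y ⊗≫ (β_ K.C Y).hom ▷ K.C ⊗≫ Y ◁ (β_ K.C K.C).hom) ⊗≫
          X ◁ (β_ K.C Y).hom ▷ (K.C ⊗ K.C) ⊗≫ X ◁ Y ◁ K.pairingInv ▷ K.C ⊗≫ X ◁ K.coact Y ▷ K.C ⊗≫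
          𝟙 ((X ⊗ Y) ⊗ K.C ⊗ K.C) := by
          rw [← whisker_exchange, braiding_tensor_left_hom]
          calc _ = K.coact X ▷ Y ⊗≫ K.coact X ▷ K.C ▷ Y ⊗≫
                X ◁ K.C ◁ (K.C ◁ K.coact Y ⊗≫ (β_ K.C Y).hom ▷ K.C) ⊗≫
                X ◁ ((β_ K.C Y).hom ▷ (K.C ⊗ K.C) ≫ (Y ⊗ K.C) ◁ (β_ K.C K.C).hom) ⊗≫
                X ◁ Y ◁ K.pairingInv ▷ K.C ⊗≫ X ◁ K.coact Y ▷ K.C ⊗≫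
                𝟙 ((X ⊗ Y) ⊗ K.C ⊗ K.C) := by monoidal
            _ = _ := by rw [← whisker_exchange]; monoidal
    -- The outer leg of X now crosses Y before Y coacts. What remains in between is `coact₂ X Y`
    -- followed by `pairingInv`.
    _ = K.coact X ▷ Y ⊗≫ (K.coact X ▷ (K.C ⊗ Y) ≫ (X ⊗ K.C) ◁ (β_ K.C Y).hom) ⊗≫
          X ◁ K.C ◁ K.coact Y ▷ K.C ⊗≫
          X ◁ (β_ K.C Y).hom ▷ (K.C ⊗ K.C) ⊗≫ X ◁ Y ◁ K.pairingInv ▷ K.C ⊗≫ X ◁ K.coact Y ▷ K.C ⊗≫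
          𝟙 ((X ⊗ Y) ⊗ K.C ⊗ K.C) := by
          rw [K.braiding_coact]; monoidal
    _ = _ := by
          rw [← whisker_exchange, K.coact₂_eq]; monoidal

end CoendData
end CoactionIdentities

/-! ### Free modules and their generators -/

section FreeModules
variable {V : Type u} [Category.{v} V] [MonoidalCategory V]
namespace RMod
variable {H : V} [MonObj H]

variable (H) in
/-- The free module `X ⊗ H`. -/
@[simps] abbrev free (X : V) : RMod H where
  X := X ⊗ H
  act := (α_ X H H).hom ≫ X ◁ μ[H]
  act_one := by
    rw [associator_naturality_right_assoc, ← whiskerLeft_comp, MonObj.mul_one]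
    monoidal
  act_mul := by
    have h : H ◁ μ[H] ≫ μ[H] = (α_ H H H).inv ≫ μ[H] ▷ H ≫ μ[H] := by simp
    rw [associator_naturality_right_assoc, ← whiskerLeft_comp, h]
    monoidal

variable (H) in
/-- The inclusion of `X` into the free module on `X`. -/
def freeUnit (X : V) : X ⟶ X ⊗ H := (ρ_ X).inv ≫ X ◁ η[H]

lemma freeUnit_naturality {X Y : V} (f : X ⟶ Y) :
    f ≫ freeUnit H Y = freeUnit H X ≫ f ▷ H := by
  rw [freeUnit, freeUnit, rightUnitor_inv_naturality_assoc, Category.assoc, whisker_exchange]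

variable (H) in
/-- The morphism of free modules induced by a morphism. -/
@[simps] def freeMap {X Y : V} (f : X ⟶ Y) : free H X ⟶ free H Y where
  hom := f ▷ H
  comm := by
    change ((α_ X H H).hom ≫ X ◁ μ) ≫ f ▷ H = f ▷ H ▷ H ≫ (α_ Y H H).hom ≫ Y ◁ μ
    rw [Category.assoc, whisker_exchange, associator_naturality_left_assoc]

/-- The action, as a morphism from the free module. -/
@[simps] def freeCounit (M : RMod H) : free H M.X ⟶ M where
  hom := M.act
  comm := by
    change ((α_ M.X H H).hom ≫ M.X ◁ μ) ≫ M.act = M.act ▷ H ≫ M.act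
    rw [Category.assoc, M.act_mul, Iso.hom_inv_id_assoc]

lemma freeUnit_act (M : RMod H) : freeUnit H M.X ≫ M.act = 𝟙 M.X := by
  simp [freeUnit]

lemma freeUnit_free_act (X : V) : freeUnit H X ▷ H ≫ (free H X).act = 𝟙 (X ⊗ H) := by
  calc _ = 𝟙 (X ⊗ H) ⊗≫ X ◁ (η[H] ▷ H ≫ μ[H]) := by rw [freeUnit, free_act]; monoidal
    _ = _ := by rw [MonObj.one_mul]; monoidal

end RMod

/-! ### C-elements as natural endomorphisms; centrality -/

section Elements
variable [RigidCategory V] {K : CoendData V} {H : V} [MonObj H]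
open RMod

lemma elementAct_naturality (t : K.C ⟶ H) {M N : RMod H} (f : M ⟶ N) :
    elementAct t M ≫ f.hom = f.hom ≫ elementAct t N := by
  rw [elementAct, elementAct, Category.assoc, Category.assoc, f.comm, whisker_exchange_assoc,
    ← Category.assoc, ← K.coact_naturality, Category.assoc]

/-- On a free module, acting on the generator loses no information. The extra strand W is needed for
centrality, where both sides are morphisms C ⊗ H → H. -/
lemma freeUnit_coact_act (X W : V) (g : K.C ⊗ W ⟶ H) :
    freeUnit H X ▷ W ≫ K.coact (X ⊗ H) ▷ W ≫ (α_ (X ⊗ H) K.C W).hom ≫ (X ⊗ H) ◁ g ≫ (free H X).act =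
      K.coact X ▷ W ≫ (α_ X K.C W).hom ≫ X ◁ g := by
  calc _ = (freeUnit H X ≫ K.coact (X ⊗ H)) ▷ W ≫ (α_ (X ⊗ H) K.C W).hom ≫ (X ⊗ H) ◁ g ≫
           (free H X).act := by
        rw [comp_whiskerRight_assoc]
    _ = K.coact X ▷ W ⊗≫ (freeUnit H X ▷ (K.C ⊗ W) ≫ (X ⊗ H) ◁ g) ≫ (free H X).act := by
        rw [K.coact_naturality]; monoidal
    _ = K.coact X ▷ W ⊗≫ X ◁ g ≫ freeUnit H X ▷ H ≫ (free H X).act := by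
        rw [← whisker_exchange]; monoidal
    _ = _ := by rw [freeUnit_free_act]; monoidal

lemma freeUnit_elementAct (t : K.C ⟶ H) (X : V) :
    freeUnit H X ≫ elementAct t (free H X) = K.coact X ≫ X ◁ t := by
  change freeUnit H X ≫ K.coact (X ⊗ H) ≫ (X ⊗ H) ◁ t ≫ (free H X).act = _
  rw [← Category.assoc, K.coact_naturality, Category.assoc,
    ← whisker_exchange_assoc, freeUnit_free_act, Category.comp_id]

/-- Free modules suffice: on generators the action of t is the natural family X → X ⊗ H that
corresponds to t. -/
lemma elementAct_injective {s t : K.C ⟶ H} (h : ∀ M : RMod H, elementAct s M = elementAct t M) :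
    s = t := by
  apply K.hom_ext_coact
  intro X
  rw [← freeUnit_elementAct, h, freeUnit_elementAct]

/-- The morphism of `V` underlying a component of an endomorphism of the identity functor. -/
def component (θ : 𝟭 (RMod H) ⟶ 𝟭 (RMod H)) (M : RMod H) : M.X ⟶ M.X := (θ.app M).hom

omit [RigidCategory V] in
lemma component_naturality (θ : 𝟭 (RMod H) ⟶ 𝟭 (RMod H)) {M N : RMod H} (f : M ⟶ N) :
    f.hom ≫ component θ N = component θ M ≫ f.hom :=
  congrArg RMod.Hom.hom (θ.naturality f)

/-- The element that represents a natural endomorphism of the forgetful functor. -/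
def elementOf (K : CoendData V) (θ : 𝟭 (RMod H) ⟶ 𝟭 (RMod H)) : K.C ⟶ H :=
  (K.sigma₁ H).symm
    { app := fun X => freeUnit H X ≫ component θ (free H X)
      naturality := fun X Y f => by
        have n : f ▷ H ≫ component θ (free H Y) = component θ (free H X) ≫ f ▷ H :=
          component_naturality θ (freeMap H f)
        change f ≫ freeUnit H Y ≫ _ = (freeUnit H X ≫ _) ≫ f ▷ H
        rw [← Category.assoc, freeUnit_naturality, Category.assoc, n, Category.assoc] }

/-- The action M ⊗ H → M is a module map from a free module, split in V by the generator map.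
Naturality of θ along it reduces θ_M to its values on free generators. -/
lemma elementAct_elementOf (θ : 𝟭 (RMod H) ⟶ 𝟭 (RMod H)) (M : RMod H) :
    elementAct (elementOf K θ) M = component θ M := by
  have n : M.act ≫ component θ M = component θ (free H M.X) ≫ M.act :=
    component_naturality θ (freeCounit M)
  have e : K.coact M.X ≫ M.X ◁ elementOf K θ = freeUnit H M.X ≫ component θ (free H M.X) :=
    K.sigma₁_symm_spec _ M.X
  rw [elementAct, reassoc_of% e, ← n, ← Category.assoc, freeUnit_act, Category.id_comp]

variable [BraidedCategory V]

/-- The two sides of the centrality equation act on M as "t, then h" and "h, then t". Testing on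
free modules recovers the equation itself. -/
lemma isCentralElement_iff (t : K.C ⟶ H) : IsCentralElement t ↔
    ∀ M : RMod H, M.act ≫ elementAct t M = elementAct t M ▷ H ≫ M.act := by
  have e₁ (M : RMod H) : elementAct t M ▷ H ≫ M.act =
      K.coact M.X ▷ H ≫ (α_ M.X K.C H).hom ≫ M.X ◁ (t ▷ H ≫ μ[H]) ≫ M.act := by
    rw [whiskerLeft_comp_assoc, M.act_mul, elementAct]
    monoidal
  -- The action is a morphism M ⊗ H → M of V, so the coaction passes through it and becomes the
  -- coaction of M ⊗ H, which `mul` expresses through those of M and H. This is where δ_H enters the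
  -- notion of centrality.
  have e₂ (M : RMod H) : M.act ≫ elementAct t M =
      K.coact M.X ▷ H ≫ (α_ M.X K.C H).hom ≫ M.X ◁ (K.C ◁ K.coact H ⊗≫ (β_ K.C H).hom ▷ K.C ⊗≫
        H ◁ (K.mul ≫ t) ≫ μ[H]) ≫ M.act := by
    calc _ = (M.act ≫ K.coact M.X) ≫ M.X ◁ t ≫ M.act := by simp [elementAct]
      _ = K.coact₂ M.X H ≫ (M.X ⊗ H) ◁ (K.mul ≫ t) ≫ M.act ▷ H ≫ M.act := by
        rw [K.coact_naturality, Category.assoc, ← whisker_exchange_assoc, ← K.coact₂_mul,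
          whiskerLeft_comp, Category.assoc, Category.assoc]
      _ = K.coact M.X ▷ H ⊗≫ M.X ◁ (K.C ◁ K.coact H ⊗≫ (β_ K.C H).hom ▷ K.C ⊗≫
            H ◁ (K.mul ≫ t)) ⊗≫ ((α_ M.X H H).inv ≫ M.act ▷ H ≫ M.act) := by
        rw [K.coact₂_eq]; monoidal
      _ = _ := by rw [← M.act_mul]; monoidal
  constructor
  · intro h M
    rw [e₁, e₂, h]
  · intro h
    apply K.hom_ext_lift
    intro X
    rw [← freeUnit_coact_act, ← freeUnit_coact_act]
    exact congrArg (freeUnit H X ▷ H ≫ ·) (((e₂ _).symm.trans ((h (free H X)).trans (e₁ _))).symm)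

end Elements
end FreeModules

/-! ### Morphisms C ⊗ C → H ⊗ H acting on pairs of modules -/

section PairAction
variable {V : Type u} [Category.{v} V] [MonoidalCategory V] [BraidedCategory V] [RigidCategory V]
variable {K : CoendData V} {H : V}
open RMod

/-- The endomorphism of `M ⊗ N` represented by a morphism `C ⊗ C ⟶ H ⊗ H`. -/
def pairAct [MonObj H] (f : K.C ⊗ K.C ⟶ H ⊗ H) (M N : RMod H) : M.X ⊗ N.X ⟶ M.X ⊗ N.X :=
  K.coact₂ M.X N.X ≫ (M.X ⊗ N.X) ◁ f ≫ tensorμ M.X N.X H H ≫ (M.act ⊗ₘ N.act)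

lemma freeUnit_pairAct [MonObj H] (f : K.C ⊗ K.C ⟶ H ⊗ H) (X Y : V) :
    (freeUnit H X ⊗ₘ freeUnit H Y) ≫ pairAct f (free H X) (free H Y) =
      K.coact₂ X Y ≫ (X ⊗ Y) ◁ f ≫ tensorμ X Y H H := by
  change (freeUnit H X ⊗ₘ freeUnit H Y) ≫ K.coact₂ (X ⊗ H) (Y ⊗ H) ≫ ((X ⊗ H) ⊗ (Y ⊗ H)) ◁ f ≫
    tensorμ (X ⊗ H) (Y ⊗ H) H H ≫ ((free H X).act ⊗ₘ (free H Y).act) = _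
  rw [← Category.assoc, K.coact₂_naturality, Category.assoc, ← whisker_exchange_assoc,
    tensorμ_natural_left_assoc, tensorHom_comp_tensorHom, freeUnit_free_act, freeUnit_free_act,
    id_tensorHom_id, Category.comp_id]

lemma pairAct_injective [MonObj H] {f g : K.C ⊗ K.C ⟶ H ⊗ H}
    (h : ∀ M N : RMod H, pairAct f M N = pairAct g M N) : f = g := by
  apply K.hom_ext₂
  intro X Y
  have e := congrArg ((freeUnit H X ⊗ₘ freeUnit H Y) ≫ ·) (h (free H X) (free H Y))
  have e' := (freeUnit_pairAct f X Y).symm.trans (e.trans (freeUnit_pairAct g X Y))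
  -- The generators give the desired equation followed by `tensorμ`, which `tensorδ` inverts.
  have m := congrArg (· ≫ tensorδ X Y H H) e'
  simpa using m

/-- `pairAct` entangles the two strands on the way out of `coact₂` and again on the way to the
actions; `separate` is the correction that undoes this. -/
lemma elementAct_tensorHom [MonObj H] (t : K.C ⟶ H) (M N : RMod H) :
    elementAct t M ⊗ₘ elementAct t N = pairAct (K.separate ≫ (t ⊗ₘ t)) M N := by
  rw [pairAct, whiskerLeft_comp, Category.assoc, tensorμ_natural_right_assoc,
    ← Category.assoc, ← Category.assoc, Category.assoc _ _ (tensorμ _ _ _ _), K.coact₂_separate,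
    tensorHom_comp_tensorHom, tensorHom_comp_tensorHom]
  simp [elementAct]

variable [BimonObj H]

/-- `mul` computes the coaction of M ⊗ N, and the coproduct of H its diagonal action. -/
lemma elementAct_tensor (t : K.C ⟶ H) (M N : RMod H) :
    elementAct t (M ⊗ N) = pairAct (K.mul ≫ t ≫ Δ[H]) M N := by
  change K.coact (M.X ⊗ N.X) ≫ (M.X ⊗ N.X) ◁ t ≫ tAct M.act N.act = _
  rw [← K.coact₂_mul, tAct, pairAct]
  simp

/-- Convolution acts by iteration, because C ⊗ C coacts on M ⊗ N as a coalgebra and H ⊗ H acts as an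
algebra. The coaction feeding g precedes the action of f; exchanging them needs naturality of
`coact₂`, so in general this is not `pairAct f` followed by `pairAct g`. -/
lemma pairAct_mul₂ (f g : K.C ⊗ K.C ⟶ H ⊗ H) (M N : RMod H) :
    pairAct (K.comul₂ ≫ (f ⊗ₘ g) ≫ mul₂ H) M N =
      K.coact₂ M.X N.X ≫ (K.coact₂ M.X N.X ≫ (M.X ⊗ N.X) ◁ f ≫ tensorμ M.X N.X H H ≫
        (M.act ⊗ₘ N.act)) ▷ (K.C ⊗ K.C) ≫ (M.X ⊗ N.X) ◁ g ≫ tensorμ M.X N.X H H ≫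
        (M.act ⊗ₘ N.act) := by
  -- Associativity of the action of the braided algebra H ⊗ H on M ⊗ N.
  have a : (M.X ⊗ N.X) ◁ mul₂ H ≫ tensorμ M.X N.X H H ≫ (M.act ⊗ₘ N.act) =
      (α_ (M.X ⊗ N.X) (H ⊗ H) (H ⊗ H)).inv ≫ (tensorμ M.X N.X H H ≫ (M.act ⊗ₘ N.act)) ▷ (H ⊗ H) ≫
        tensorμ M.X N.X H H ≫ (M.act ⊗ₘ N.act) := by
    have t := tensor_associativity M.X N.X H H H H
    rw [mul₂, whiskerLeft_comp_assoc, tensorμ_natural_right_assoc, tensorHom_comp_tensorHom,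
      M.act_mul, N.act_mul, comp_whiskerRight, Category.assoc, tensorμ_natural_left_assoc,
      tensorHom_comp_tensorHom, ← tensorHom_comp_tensorHom (α_ M.X H H).inv,
      eq_comm, Iso.inv_comp_eq, ← reassoc_of% t, tensorHom_comp_tensorHom_assoc]
    simp
  have c := K.coact₂_comul₂ M.X N.X
  rw [pairAct, whiskerLeft_comp_assoc, reassoc_of% c, whiskerLeft_comp_assoc, a]
  congr 1
  rw [MonoidalCategory.tensorHom_def]
  simp only [comp_whiskerRight, Category.assoc, whiskerLeft_comp]
  congr 1
  rw [← whisker_exchange_assoc, ← whisker_exchange_assoc]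
  simp

end PairAction

/-! ### The double braiding of modules is represented by Q -/

section DoubleBraiding
variable {V : Type u} [Category.{v} V] [MonoidalCategory V] [BraidedCategory V] [RigidCategory V]
variable (K : CoendData V)

/-- Needed with Z = H: in the double braiding the second coaction is taken on objects such as Y ⊗ H,
which still carry an H waiting to act. -/
lemma CoendData.coact₂_tensor_right (X Y Z : V) : K.coact₂ X (Y ⊗ Z) =
    𝟙 (X ⊗ Y ⊗ Z) ⊗≫ K.coact₂ X Y ▷ Z ⊗≫ (X ⊗ Y) ◁ ((K.C ⊗ K.C) ◁ K.coact Z ⊗≫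
    (β_ (K.C ⊗ K.C) Z).hom ▷ K.C ⊗≫
      Z ◁ K.C ◁ K.mul) ⊗≫ 𝟙 ((X ⊗ (Y ⊗ Z)) ⊗ K.C ⊗ K.C) := by
  calc _ = K.coact X ▷ (Y ⊗ Z) ⊗≫ X ◁ K.C ◁ (K.coact₂ Y Z) ⊗≫ (X ◁ (K.C ⊗ (Y ⊗ Z)) ◁ K.mul ≫
        X ◁ (β_ K.C (Y ⊗ Z)).hom ▷ K.C) ⊗≫ 𝟙 ((X ⊗ (Y ⊗ Z)) ⊗ K.C ⊗ K.C) := by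
        rw [K.coact₂_eq, ← K.coact₂_mul]; monoidal
    _ = K.coact X ▷ (Y ⊗ Z) ⊗≫ X ◁ K.C ◁ K.coact Y ▷ Z ⊗≫
        X ◁ ((K.C ⊗ Y) ◁ (K.C ◁ K.coact Z ⊗≫ (β_ K.C Z).hom ▷ K.C) ≫
          (β_ K.C Y).hom ▷ ((Z ⊗ K.C) ⊗ K.C)) ⊗≫ X ◁ Y ◁ (β_ K.C Z).hom ▷ (K.C ⊗ K.C) ⊗≫
        X ◁ Y ◁ Z ◁ K.C ◁ K.mul ⊗≫ 𝟙 ((X ⊗ (Y ⊗ Z)) ⊗ K.C ⊗ K.C) := by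
        rw [← whiskerLeft_comp, whisker_exchange, K.coact₂_eq Y Z, braiding_tensor_right_hom]
        monoidal
    _ = _ := by
        rw [whisker_exchange, K.coact₂_eq, braiding_tensor_left_hom]; monoidal

/-- Conjugating the coactions of Y and X by the crossings of X and Y is the situation of
`coact₂_exchange`; Z, A and B are spectators. This is the source of `exchange` in Q. -/
lemma CoendData.braiding_coact₂_braiding (X Y Z : V) {A B : V} (k : K.C ⊗ K.C ⟶ A ⊗ B) :
    (β_ X Y).hom ▷ Z ≫ (α_ Y X Z).hom ≫ K.coact₂ Y (X ⊗ Z) ≫ (Y ⊗ X ⊗ Z) ◁ k ≫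
      (α_ (Y ⊗ X ⊗ Z) A B).inv ≫ (α_ Y (X ⊗ Z) A).hom ▷ B ≫ (β_ Y ((X ⊗ Z) ⊗ A)).hom ▷ B =
    K.coact₂ X Y ▷ Z ⊗≫ (X ⊗ Y) ◁ K.exchange ▷ Z ⊗≫ (X ⊗ Y) ◁ ((K.C ⊗ K.C) ◁ K.coact Z ⊗≫
      (β_ (K.C ⊗ K.C) Z).hom ▷ K.C ⊗≫ Z ◁ (K.C ◁ K.mul ⊗≫ k)) ⊗≫ X ◁ (β_ Y (Z ⊗ A)).hom ▷ B ⊗≫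
      𝟙 ((((X ⊗ Z) ⊗ A) ⊗ Y) ⊗ B) := by
  calc _ = (β_ X Y).hom ▷ Z ⊗≫ K.coact₂ Y X ▷ Z ⊗≫ ((Y ⊗ X) ◁ ((K.C ⊗ K.C) ◁ K.coact Z ⊗≫
        (β_ (K.C ⊗ K.C) Z).hom ▷ K.C ⊗≫ Z ◁ (K.C ◁ K.mul ⊗≫ k)) ≫ (β_ Y X).hom ▷ (Z ⊗ (A ⊗ B))) ⊗≫
        X ◁ (β_ Y (Z ⊗ A)).hom ▷ B ⊗≫ 𝟙 ((((X ⊗ Z) ⊗ A) ⊗ Y) ⊗ B) := by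
        rw [K.coact₂_tensor_right, braiding_tensor_right_hom Y (X ⊗ Z) A,
          braiding_tensor_right_hom Y X Z, braiding_tensor_right_hom Y Z A]; monoidal
    _ = ((β_ X Y).hom ≫ K.coact₂ Y X ≫ (β_ Y X).hom ▷ (K.C ⊗ K.C)) ▷ Z ⊗≫
        (X ⊗ Y) ◁ ((K.C ⊗ K.C) ◁ K.coact Z ⊗≫
        (β_ (K.C ⊗ K.C) Z).hom ▷ K.C ⊗≫ Z ◁ (K.C ◁ K.mul ⊗≫ k)) ⊗≫
        X ◁ (β_ Y (Z ⊗ A)).hom ▷ B ⊗≫ 𝟙 ((((X ⊗ Z) ⊗ A) ⊗ Y) ⊗ B) := by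
        rw [whisker_exchange]; monoidal
    _ = _ := by
        rw [← K.coact₂_exchange]; monoidal

variable {K} {H : V} [BimonObj H]

/-- The actions of the first braiding are postponed until after the second, where two successive
actions merge into one by a product in H. Above them only coactions, crossings and two copies of the
R-matrix remain. -/
lemma RMatrix.braid_braid (R : RMatrix K H) (M N : RMod H) :
    R.braid M N ≫ R.braid N M = pairAct R.doubleBraid M N := by
  obtain ⟨X, r, hr₁, hr⟩ := M
  obtain ⟨Y, s, hs₁, hs⟩ := N
  have e : (s ⊗ₘ r) ≫ K.coact₂ Y X = K.coact₂ (Y ⊗ H) (X ⊗ H) ≫ (s ⊗ₘ r) ▷ (K.C ⊗ K.C) :=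
    K.coact₂_naturality s r
  -- A stands for the merged actions and enters only through `hA`, so this part is a pure diagram
  -- identity in V.
  have key (A : (X ⊗ H ⊗ H) ⊗ (Y ⊗ H ⊗ H) ⟶ X ⊗ Y)
      (hA : tensorμ X Y (H ⊗ H) (H ⊗ H) ≫ A = (X ⊗ Y) ◁ (μ[H] ⊗ₘ μ[H]) ≫ tensorμ X Y H H ≫
      (r ⊗ₘ s)) :
      K.coact₂ X Y ≫ (X ⊗ Y) ◁ R.hom ⊗≫ ((β_ X (Y ⊗ H)).hom ▷ H ≫ (α_ (Y ⊗ H) X H).hom ≫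
        K.coact₂ (Y ⊗ H) (X ⊗ H) ≫ ((Y ⊗ H) ⊗ (X ⊗ H)) ◁ R.hom ≫
        (α_ ((Y ⊗ H) ⊗ X ⊗ H) H H).inv ≫ (α_ (Y ⊗ H) (X ⊗ H) H).hom ▷ H ≫
        (β_ (Y ⊗ H) ((X ⊗ H) ⊗ H)).hom ▷ H) ⊗≫
        A = K.coact₂ X Y ≫ (X ⊗ Y) ◁ R.doubleBraid ≫ tensorμ X Y H H ≫ (r ⊗ₘ s) := by
    calc _ = K.coact₂ X Y ≫ (X ⊗ Y) ◁ R.hom ⊗≫ K.coact₂ X (Y ⊗ H) ▷ H ⊗≫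
             (X ⊗ (Y ⊗ H)) ◁ K.exchange ▷ H ⊗≫
          (X ⊗ (Y ⊗ H)) ◁ ((K.C ⊗ K.C) ◁ K.coact H ⊗≫
        (β_ (K.C ⊗ K.C) H).hom ▷ K.C ⊗≫ H ◁ (K.C ◁ K.mul ⊗≫ R.hom)) ⊗≫
        X ◁ (β_ (Y ⊗ H) (H ⊗ H)).hom ▷ H ⊗≫
          A := by
          rw [K.braiding_coact₂_braiding]; monoidal
      _ = K.coact₂ X Y ≫ ((X ⊗ Y) ◁ R.hom ≫ K.coact₂ X Y ▷ (H ⊗ H)) ⊗≫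
          (X ⊗ Y) ◁ (𝟙 ((K.C ⊗ K.C) ⊗ (H ⊗ H)) ⊗≫
          (((K.C ⊗ K.C) ◁ K.coact H ⊗≫ (β_ (K.C ⊗ K.C) H).hom ▷ K.C ⊗≫ H ◁ K.C ◁ K.mul ⊗≫
            H ◁ K.exchange) ▷ H ≫ (H ⊗ (K.C ⊗ K.C)) ◁ K.coact H) ⊗≫
          H ◁ (β_ (K.C ⊗ K.C) H).hom ▷ K.C ⊗≫ H ◁ H ◁ K.C ◁ K.mul ⊗≫ H ◁ H ◁ R.hom ⊗≫
          (β_ H (H ⊗ H)).hom ▷ H ⊗≫ 𝟙 ((H ⊗ H) ⊗ (H ⊗ H))) ≫ tensorμ X Y (H ⊗ H) (H ⊗ H) ≫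
          A := by
          rw [K.coact₂_tensor_right, braiding_tensor_left_hom Y H, tensorμ]; monoidal
      -- The coactions of the two braidings are now consecutive coactions on X ⊗ Y, so they combine
      -- into one coaction followed by `comul₂`.
      _ = (K.coact₂ X Y ≫ (X ⊗ Y) ◁ K.comul₂) ⊗≫
          (X ⊗ Y) ◁ ((K.C ⊗ K.C) ◁ R.hom ⊗≫
          (((K.C ⊗ K.C) ⊗ H) ◁ K.coact H ≫
            ((K.C ⊗ K.C) ◁ K.coact H ⊗≫ (β_ (K.C ⊗ K.C) H).hom ▷ K.C ⊗≫ H ◁ K.C ◁ K.mul ⊗≫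
            H ◁ K.exchange) ▷ (H ⊗ K.C)) ⊗≫
          H ◁ (β_ (K.C ⊗ K.C) H).hom ▷ K.C ⊗≫ H ◁ H ◁ K.C ◁ K.mul ⊗≫ H ◁ H ◁ R.hom ⊗≫
          (β_ H (H ⊗ H)).hom ▷ H ⊗≫ 𝟙 ((H ⊗ H) ⊗ (H ⊗ H))) ≫
          ((X ⊗ Y) ◁ (μ[H] ⊗ₘ μ[H]) ≫ tensorμ X Y H H) ≫ (r ⊗ₘ s) := by
          rw [whisker_exchange, ← whisker_exchange _ (K.coact H), K.coact₂_comul₂,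
            hA]; monoidal
      _ = _ := by
          rw [RMatrix.doubleBraid, MonoidalCategory.tensorHom_def' (K.coact H)]; monoidal
  change (K.coact₂ X Y ≫ (X ⊗ Y) ◁ R.hom ⊗≫ (β_ X (Y ⊗ H)).hom ▷ H ⊗≫ (s ⊗ₘ r)) ≫
    K.coact₂ Y X ≫ (Y ⊗ X) ◁ R.hom ⊗≫ (β_ Y (X ⊗ H)).hom ▷ H ⊗≫ (r ⊗ₘ s) =
    K.coact₂ X Y ≫ (X ⊗ Y) ◁ R.doubleBraid ≫ tensorμ X Y H H ≫ (r ⊗ₘ s)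
  calc _ = K.coact₂ X Y ≫ (X ⊗ Y) ◁ R.hom ⊗≫ (β_ X (Y ⊗ H)).hom ▷ H ⊗≫
        K.coact₂ (Y ⊗ H) (X ⊗ H) ⊗≫ ((s ⊗ₘ r) ▷ (K.C ⊗ K.C) ≫ (Y ⊗ X) ◁ R.hom) ⊗≫
        (β_ Y (X ⊗ H)).hom ▷ H ⊗≫ (r ⊗ₘ s) := by
        calc _ = K.coact₂ X Y ≫ (X ⊗ Y) ◁ R.hom ⊗≫ (β_ X (Y ⊗ H)).hom ▷ H ⊗≫
              ((s ⊗ₘ r) ≫ K.coact₂ Y X) ⊗≫ (Y ⊗ X) ◁ R.hom ⊗≫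
              (β_ Y (X ⊗ H)).hom ▷ H ⊗≫ (r ⊗ₘ s) := by monoidal
          _ = _ := by rw [e]; monoidal
    _ = K.coact₂ X Y ≫ (X ⊗ Y) ◁ R.hom ⊗≫ ((β_ X (Y ⊗ H)).hom ▷ H ≫ (α_ (Y ⊗ H) X H).hom ≫
        K.coact₂ (Y ⊗ H) (X ⊗ H) ≫ ((Y ⊗ H) ⊗ (X ⊗ H)) ◁ R.hom ≫
        (α_ ((Y ⊗ H) ⊗ X ⊗ H) H H).inv ≫ (α_ (Y ⊗ H) (X ⊗ H) H).hom ▷ H ≫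
        (β_ (Y ⊗ H) ((X ⊗ H) ⊗ H)).hom ▷ H) ⊗≫
        (((α_ X H H).inv ≫ r ▷ H ≫ r) ⊗ₘ ((α_ Y H H).inv ≫ s ▷ H ≫ s)) := by
        calc _ = K.coact₂ X Y ≫ (X ⊗ Y) ◁ R.hom ⊗≫ (β_ X (Y ⊗ H)).hom ▷ H ⊗≫
              K.coact₂ (Y ⊗ H) (X ⊗ H) ⊗≫ ((Y ⊗ H) ⊗ (X ⊗ H)) ◁ R.hom ⊗≫
              ((s ⊗ₘ (r ▷ H)) ≫ (β_ Y (X ⊗ H)).hom) ▷ H ⊗≫ (r ⊗ₘ s) := by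
              rw [← whisker_exchange]; monoidal
          _ = K.coact₂ X Y ≫ (X ⊗ Y) ◁ R.hom ⊗≫ ((β_ X (Y ⊗ H)).hom ▷ H ⊗≫
              K.coact₂ (Y ⊗ H) (X ⊗ H) ⊗≫ ((Y ⊗ H) ⊗ (X ⊗ H)) ◁ R.hom ⊗≫
              (β_ (Y ⊗ H) ((X ⊗ H) ⊗ H)).hom ▷ H) ⊗≫
              ((r ▷ H ⊗ₘ s ▷ H) ≫ (r ⊗ₘ s)) := by
              rw [braiding_naturality]; monoidal
          _ = _ := by
              rw [tensorHom_comp_tensorHom, ← tensorHom_comp_tensorHom (α_ X H H).inv]; monoidal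
    _ = _ := by
        apply key
        rw [← hr, ← hs, tensorμ_natural_right_assoc, tensorHom_comp_tensorHom]

end DoubleBraiding

/-! ### Balanced structures and balanced elements -/

section Balanced
variable {V : Type u} [Category.{v} V] [MonoidalCategory V] [BraidedCategory V] [RigidCategory V]
variable {K : CoendData V} {H : V}
open RMod

/-- Coactions commute with all morphisms of V, actions only with module maps; hence linearity of f
and g is essential. -/
lemma pairAct_naturality [MonObj H] (q : K.C ⊗ K.C ⟶ H ⊗ H) {M N M' N' : RMod H}
    (f : M ⟶ M') (g : N ⟶ N') :
    (f.hom ⊗ₘ g.hom) ≫ pairAct q M' N' = pairAct q M N ≫ (f.hom ⊗ₘ g.hom) := by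
  rw [pairAct, pairAct, ← Category.assoc, K.coact₂_naturality, Category.assoc,
    ← whisker_exchange_assoc, tensorμ_natural_left_assoc, tensorHom_comp_tensorHom,
    ← f.comm, ← g.comm]
  simp

variable [BimonObj H]

lemma elementAct_unit (t : K.C ⟶ H) : elementAct t (𝟙_ (RMod H)) = K.unit ≫ t ≫ ε[H] := by
  change K.coact (𝟙_ V) ≫ 𝟙_ V ◁ t ≫ (λ_ H).hom ≫ ε[H] = _
  rw [leftUnitor_naturality_assoc, CoendData.unit, Category.assoc]

/-- A central element acts by module endomorphisms. -/
@[simps] def elementHom (t : K.C ⟶ H) (h : IsCentralElement t) (M : RMod H) : M ⟶ M where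
  hom := elementAct t M
  comm := (isCentralElement_iff t).1 h M

lemma pairAct_twist (R : RMatrix K H) (t : K.C ⟶ H) (h : IsCentralElement t) (M N : RMod H) :
    pairAct (K.comul₂ ≫ ((K.separate ≫ (t ⊗ₘ t)) ⊗ₘ R.doubleBraid) ≫ mul₂ H) M N =
      R.braid M N ≫ R.braid N M ≫ (elementAct t M ⊗ₘ elementAct t N) := by
  have e : pairAct (K.separate ≫ (t ⊗ₘ t)) M N = K.coact₂ M.X N.X ≫
      (M.X ⊗ N.X) ◁ (K.separate ≫ (t ⊗ₘ t)) ≫ tensorμ M.X N.X H H ≫ (M.act ⊗ₘ N.act) := rfl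
  rw [pairAct_mul₂, ← e, ← elementAct_tensorHom, ← Category.assoc, ← K.coact₂_naturality,
    Category.assoc]
  -- Centrality makes the action of t a module map, so it moves from before the double braiding to
  -- after it.
  refine (pairAct_naturality R.doubleBraid (elementHom t h M) (elementHom t h N)).trans ?_
  rw [← R.braid_braid, Category.assoc]
  rfl

/-- Balanced structures correspond to balanced elements. -/
def RMatrix.balancedEquiv (R : RMatrix K H) :
    R.BalancedStructure ≃ {t : K.C ⟶ H // R.IsBalancedElement t} where
  toFun b :=
    have c : IsCentralElement (elementOf K b.θ) := by
      rw [isCentralElement_iff]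
      intro M
      rw [elementAct_elementOf]
      exact (b.θ.app M).comm
    ⟨elementOf K b.θ,
      { central := c
        counit := by
          rw [← elementAct_unit, elementAct_elementOf]
          exact congrArg RMod.Hom.hom b.unit
        twist := by
          -- (CT3) is tested on all pairs of modules, where it becomes the balancing axiom.
          apply pairAct_injective
          intro M N
          rw [pairAct_twist R _ c, ← elementAct_tensor]
          simp only [elementAct_elementOf]
          exact b.tensor M N }⟩
  invFun t :=
    { θ :=
        { app := elementHom t.1 t.2.central
          naturality := fun M N f => RMod.Hom.ext (elementAct_naturality t.1 f).symm }
      tensor := fun M N => by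
        change elementAct t.1 (M ⊗ N) = _ ≫ _ ≫ (elementAct t.1 M ⊗ₘ elementAct t.1 N)
        rw [elementAct_tensor, t.2.twist, pairAct_twist R _ t.2.central]
        rfl
      unit := RMod.Hom.ext ((elementAct_unit t.1).trans t.2.counit) }
  left_inv b := by
    apply RMatrix.BalancedStructure.ext
    apply NatTrans.ext
    funext M
    exact RMod.Hom.ext (elementAct_elementOf b.θ M)
  right_inv t := by
    apply Subtype.ext
    apply elementAct_injective
    intro M
    rw [elementAct_elementOf]
    rfl

end Balanced

/-! ### The antipode of C and coactions of dual objects -/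

section Ribbon
open ExactPairing
variable {V : Type u} [Category.{v} V] [MonoidalCategory V] [BraidedCategory V] [RigidCategory V]
variable (K : CoendData V)

namespace CoendData

/-- The coaction of the dual of `X`, bent to a map `X ⟶ C ⊗ X`. -/
def leftDualCoact (X : V) : X ⟶ K.C ⊗ X :=
  𝟙 X ⊗≫ X ◁ η_ (ᘁX : V) X ⊗≫ X ◁ K.coact (ᘁX : V) ▷ X ⊗≫ ε_ (ᘁX : V) X ▷ (K.C ⊗ X) ⊗≫
    𝟙 (K.C ⊗ X)

lemma dualCoact_eq (X : V) : K.dualCoact X = K.leftDualCoact X ≫ (β_ X K.C).inv := by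
  rw [dualCoact, leftDualCoact]; monoidal

lemma leftDualCoact_naturality {X Y : V} (f : X ⟶ Y) :
    f ≫ K.leftDualCoact Y = K.leftDualCoact X ≫ K.C ◁ f := by
  have h := K.dualCoact_naturality f
  rw [dualCoact_eq, dualCoact_eq, Category.assoc, ← braiding_inv_naturality_right,
    ← Category.assoc, ← Category.assoc, cancel_mono] at h
  exact h

/-- The left side is the upper half of S(a) applied to a coaction. There `mul` joins the coactions
of X and H into that of X ⊗ H, and `antipode` replaces it by the coaction of the dual of X ⊗ H; the
crossings of X with P only bring X next to H. -/
lemma coact_antipode_tensor (X H P : V) (j : 𝟙_ V ⟶ P ⊗ H) :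
    K.coact X ⊗≫ X ◁ (K.C ◁ j ⊗≫ K.C ◁ P ◁ K.coact H ⊗≫ (β_ K.C (P ⊗ H)).hom ▷ K.C ⊗≫
      (P ⊗ H) ◁ (K.mul ≫ K.antipode)) =
    𝟙 X ⊗≫ X ◁ j ⊗≫ (β_ X P).hom ▷ H ⊗≫ P ◁ K.leftDualCoact (X ⊗ H) ⊗≫
      P ◁ (β_ (X ⊗ H) K.C).inv ⊗≫ (β_ X P).inv ▷ (H ⊗ K.C) ⊗≫ 𝟙 (X ⊗ ((P ⊗ H) ⊗ K.C)) := by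
  symm
  calc _ = 𝟙 X ⊗≫ X ◁ j ⊗≫ (β_ X P).hom ▷ H ⊗≫ P ◁ (K.coact (X ⊗ H) ≫ (X ⊗ H) ◁ K.antipode) ⊗≫
        (β_ X P).inv ▷ (H ⊗ K.C) ⊗≫ 𝟙 (X ⊗ ((P ⊗ H) ⊗ K.C)) := by
        rw [K.coact_antipode, K.dualCoact_eq]; monoidal
    _ = 𝟙 X ⊗≫ X ◁ j ⊗≫ (((β_ X P).hom ≫ P ◁ K.coact X) ⊗≫ 𝟙 ((P ⊗ X) ⊗ K.C)) ▷ H ⊗≫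
        (P ⊗ X) ◁ (K.C ◁ K.coact H ⊗≫ (β_ K.C H).hom ▷ K.C ⊗≫ H ◁ (K.mul ≫ K.antipode)) ⊗≫
        (β_ X P).inv ▷ (H ⊗ K.C) ⊗≫ 𝟙 (X ⊗ ((P ⊗ H) ⊗ K.C)) := by
        rw [← K.coact₂_mul, K.coact₂_eq]; monoidal
    _ = 𝟙 X ⊗≫ X ◁ j ⊗≫ (K.coact X ▷ P ⊗≫ X ◁ (β_ K.C P).hom) ▷ H ⊗≫ ((β_ X P).hom ▷ (K.C ⊗ H) ≫
        (P ⊗ X) ◁ (K.C ◁ K.coact H ⊗≫ (β_ K.C H).hom ▷ K.C ⊗≫ H ◁ (K.mul ≫ K.antipode))) ⊗≫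
        (β_ X P).inv ▷ (H ⊗ K.C) ⊗≫ 𝟙 (X ⊗ ((P ⊗ H) ⊗ K.C)) := by
        rw [← K.coact_braiding]; monoidal
    _ = 𝟙 X ⊗≫ (X ◁ j ≫ K.coact X ▷ (P ⊗ H)) ⊗≫ X ◁ (β_ K.C P).hom ▷ H ⊗≫
        (X ⊗ P) ◁ (K.C ◁ K.coact H ⊗≫ (β_ K.C H).hom ▷ K.C ⊗≫ H ◁ (K.mul ≫ K.antipode)) ⊗≫
        ((β_ X P).hom ≫ (β_ X P).inv) ▷ (H ⊗ K.C) ⊗≫ 𝟙 (X ⊗ ((P ⊗ H) ⊗ K.C)) := by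
        rw [← whisker_exchange]; monoidal
    _ = K.coact X ⊗≫ X ◁ K.C ◁ j ⊗≫ X ◁ ((β_ K.C P).hom ▷ H ≫
        (P ⊗ K.C) ◁ K.coact H) ⊗≫ X ◁ P ◁ (β_ K.C H).hom ▷ K.C ⊗≫ X ◁ P ◁ H ◁ (K.mul ≫
        K.antipode) ⊗≫
        𝟙 (X ⊗ ((P ⊗ H) ⊗ K.C)) := by
        rw [whisker_exchange, Iso.hom_inv_id]; monoidal
    _ = _ := by
        rw [← whisker_exchange, braiding_tensor_right_hom]; monoidal

end CoendData
end Ribbon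

/-! ### Ribbon structures and ribbon elements -/

section RibbonElements
open ExactPairing RMod
variable {V : Type u} [Category.{v} V] [MonoidalCategory V] [BraidedCategory V] [RigidCategory V]
variable {K : CoendData V}

omit [RigidCategory V] in
/-- A zigzag in which the strand `X` passes over the bent strand `H`. -/
lemma braiding_coevaluation_evaluation (X H P : V) [ExactPairing P H] :
    (β_ X H).hom ⊗≫ H ◁ X ◁ η_ P H ⊗≫ H ◁ (β_ X P).hom ▷ H ⊗≫ ε_ P H ▷ (X ⊗ H) =
      𝟙 (X ⊗ H) ⊗≫ 𝟙 (𝟙_ V ⊗ X ⊗ H) := by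
  have z := coevaluation_evaluation'' P H
  calc _ = 𝟙 (X ⊗ H) ⊗≫ ((β_ X H).hom ▷ (𝟙_ V) ≫ (H ⊗ X) ◁ η_ P H) ⊗≫ H ◁ (β_ X P).hom ▷ H ⊗≫
        ε_ P H ▷ (X ⊗ H) := by monoidal
    _ = 𝟙 (X ⊗ H) ⊗≫ (X ⊗ H) ◁ η_ P H ⊗≫ ((β_ X (H ⊗ P)).hom ≫ ε_ P H ▷ X) ▷ H ⊗≫
        𝟙 (𝟙_ V ⊗ X ⊗ H) := by
        rw [← whisker_exchange, braiding_tensor_right_hom]; monoidal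
    _ = 𝟙 (X ⊗ H) ⊗≫ X ◁ (H ◁ η_ P H ⊗≫ ε_ P H ▷ H) ⊗≫ 𝟙 (𝟙_ V ⊗ X ⊗ H) := by
        rw [← braiding_naturality_right, braiding_tensorUnit_right]; monoidal
    _ = _ := by rw [z]; monoidal

-- The H-strand bent by η and ε straightens out, so τ(C) is inserted directly as the H-argument of
-- e.
omit [RigidCategory V] in
lemma pairing_eq (X H P D C : V) [ExactPairing P H] (τ : C ⟶ H) (e : (X ⊗ H) ⊗ D ⟶ 𝟙_ V) :
    𝟙 (X ⊗ D ⊗ C) ⊗≫ X ◁ η_ P H ▷ (D ⊗ C) ⊗≫ (β_ X P).hom ▷ (H ⊗ D ⊗ C) ⊗≫ P ◁ e ▷ C ⊗≫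
      (β_ P C).hom ≫ τ ▷ P ≫ ε_ P H =
    X ◁ (β_ D C).hom ⊗≫ X ◁ τ ▷ D ⊗≫ e := by
  -- The whole subdiagram ending in P slides under the crossing with C, which brings the two bends
  -- of H together.
  have hF (F : X ⊗ D ⟶ P) : F ▷ C ≫ (β_ P C).hom ≫ τ ▷ P ≫ ε_ P H =
      (β_ (X ⊗ D) C).hom ≫ τ ▷ (X ⊗ D) ≫ H ◁ F ≫ ε_ P H := by
    rw [braiding_naturality_left_assoc, whisker_exchange_assoc]
  calc _ = 𝟙 (X ⊗ D ⊗ C) ⊗≫ ((𝟙 (X ⊗ D) ⊗≫ X ◁ η_ P H ▷ D ⊗≫ (β_ X P).hom ▷ (H ⊗ D) ⊗≫ P ◁ e ⊗≫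
      𝟙 P) ▷ C ≫ (β_ P C).hom ≫ τ ▷ P ≫ ε_ P H) := by monoidal
    _ = 𝟙 (X ⊗ D ⊗ C) ⊗≫ X ◁ (β_ D C).hom ⊗≫ ((β_ X C).hom ≫ τ ▷ X) ▷ D ⊗≫
        H ◁ (X ◁ η_ P H ▷ D ⊗≫ (β_ X P).hom ▷ (H ⊗ D)) ⊗≫ ((H ⊗ P) ◁ e ≫ ε_ P H ▷ (𝟙_ V)) ⊗≫
        𝟙 (𝟙_ V) := by
        rw [hF, braiding_tensor_left_hom]; monoidal
    _ = 𝟙 (X ⊗ D ⊗ C) ⊗≫ X ◁ (β_ D C).hom ⊗≫ X ◁ τ ▷ D ⊗≫ ((β_ X H).hom ⊗≫ H ◁ X ◁ η_ P H ⊗≫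
        H ◁ (β_ X P).hom ▷ H ⊗≫ ε_ P H ▷ (X ⊗ H)) ▷ D ⊗≫ e := by
        rw [← braiding_naturality_right, whisker_exchange]; monoidal
    _ = _ := by
        rw [braiding_coevaluation_evaluation]; monoidal

variable {H : V} [HopfObj H]

/-- S(t) involves the coaction of the dual of M ⊗ H, but the action M ⊗ H → M follows it. Naturality
along this action replaces that coaction by the one of the dual of M, and the auxiliary dual of H
then disappears by `pairing_eq`. -/
lemma elementAct_elementAntipode (t : K.C ⟶ H) (M : RMod H) :
    elementAct (elementAntipode t) M =
      𝟙 M.X ⊗≫ M.X ◁ η_ (ᘁM.X : V) M.X ⊗≫ M.X ◁ K.coact (ᘁM.X : V) ▷ M.X ⊗≫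
        (M.X ◁ (β_ (ᘁM.X : V) K.C).hom ⊗≫ M.X ◁ (t ≫ 𝒮[H]) ▷ (ᘁM.X : V) ⊗≫
          (M.act ▷ (ᘁM.X : V) ≫ ε_ (ᘁM.X : V) M.X)) ▷ M.X ⊗≫ 𝟙 M.X := by
  obtain ⟨X, r, hr₁, hr⟩ := M
  change K.coact X ≫ X ◁ elementAntipode t ≫ r = 𝟙 X ⊗≫ X ◁ η_ (ᘁX : V) X ⊗≫
    X ◁ K.coact (ᘁX : V) ▷ X ⊗≫ (X ◁ (β_ (ᘁX : V) K.C).hom ⊗≫ X ◁ (t ≫ 𝒮[H]) ▷ (ᘁX : V) ⊗≫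
          (r ▷ (ᘁX : V) ≫ ε_ (ᘁX : V) X)) ▷ X ⊗≫ 𝟙 X
  rw [← pairing_eq X H (ᘁH : V) (ᘁX : V) K.C]
  rw [elementAntipode]
  generalize t ≫ 𝒮[H] = τ
  calc _ = (K.coact X ⊗≫ X ◁ (K.C ◁ η_ (ᘁH : V) H ⊗≫ K.C ◁ (ᘁH : V) ◁ K.coact H ⊗≫
        (β_ K.C ((ᘁH : V) ⊗ H)).hom ▷ K.C ⊗≫ ((ᘁH : V) ⊗ H) ◁ (K.mul ≫ K.antipode))) ⊗≫
        X ◁ ((β_ ((ᘁH : V) ⊗ H) K.C).hom ⊗≫ τ ▷ ((ᘁH : V) ⊗ H) ⊗≫ ε_ (ᘁH : V) H ▷ H ⊗≫ 𝟙 H) ≫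
        r := by
        monoidal
    _ = 𝟙 X ⊗≫ X ◁ η_ (ᘁH : V) H ⊗≫ (β_ X (ᘁH : V)).hom ▷ H ⊗≫ (ᘁH : V) ◁ K.leftDualCoact (X ⊗ H) ⊗≫
        (ᘁH : V) ◁ (β_ X K.C).inv ▷ H ⊗≫ (ᘁH : V) ◁ X ◁ (β_ H K.C).inv ⊗≫
        (β_ X (ᘁH : V)).inv ▷ (H ⊗ K.C) ⊗≫ X ◁ (ᘁH : V) ◁ (β_ H K.C).hom ⊗≫
        X ◁ ((β_ (ᘁH : V) K.C).hom ≫ τ ▷ (ᘁH : V) ≫ ε_ (ᘁH : V) H) ▷ H ⊗≫ r := by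
        rw [K.coact_antipode_tensor, braiding_tensor_left_inv, braiding_tensor_left_hom]; monoidal
    -- The inverse crossing of H and C from `dualCoact` cancels the crossing built into
    -- `elementAntipode`.
    _ = 𝟙 X ⊗≫ X ◁ η_ (ᘁH : V) H ⊗≫ (β_ X (ᘁH : V)).hom ▷ H ⊗≫ (ᘁH : V) ◁ K.leftDualCoact (X ⊗ H) ⊗≫
        ((β_ X ((ᘁH : V) ⊗ K.C)).inv ≫ X ◁ ((β_ (ᘁH : V) K.C).hom ≫ τ ▷ (ᘁH : V) ≫
        ε_ (ᘁH : V) H)) ▷ H ⊗≫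
        r := by
        calc _ = 𝟙 X ⊗≫ X ◁ η_ (ᘁH : V) H ⊗≫ (β_ X (ᘁH : V)).hom ▷ H ⊗≫
              (ᘁH : V) ◁ K.leftDualCoact (X ⊗ H) ⊗≫ (ᘁH : V) ◁ (β_ X K.C).inv ▷ H ⊗≫
              (((ᘁH : V) ⊗ X) ◁ (β_ H K.C).inv ≫ (β_ X (ᘁH : V)).inv ▷ (H ⊗ K.C)) ⊗≫
              X ◁ (ᘁH : V) ◁ (β_ H K.C).hom ⊗≫
              X ◁ ((β_ (ᘁH : V) K.C).hom ≫ τ ▷ (ᘁH : V) ≫ ε_ (ᘁH : V) H) ▷ H ⊗≫ r := by monoidal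
          _ = 𝟙 X ⊗≫ X ◁ η_ (ᘁH : V) H ⊗≫ (β_ X (ᘁH : V)).hom ▷ H ⊗≫
              (ᘁH : V) ◁ K.leftDualCoact (X ⊗ H) ⊗≫ (ᘁH : V) ◁ (β_ X K.C).inv ▷ H ⊗≫
              (β_ X (ᘁH : V)).inv ▷ (K.C ⊗ H) ⊗≫
              X ◁ (ᘁH : V) ◁ ((β_ H K.C).inv ≫ (β_ H K.C).hom) ⊗≫
              X ◁ ((β_ (ᘁH : V) K.C).hom ≫ τ ▷ (ᘁH : V) ≫ ε_ (ᘁH : V) H) ▷ H ⊗≫ r := by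
              rw [whisker_exchange]; monoidal
          _ = _ := by
              rw [Iso.inv_hom_id, braiding_tensor_right_inv]; monoidal
    _ = 𝟙 X ⊗≫ X ◁ η_ (ᘁH : V) H ⊗≫ (β_ X (ᘁH : V)).hom ▷ H ⊗≫ (ᘁH : V) ◁ K.leftDualCoact (X ⊗ H) ⊗≫
        (((β_ (ᘁH : V) K.C).hom ≫ τ ▷ (ᘁH : V) ≫ ε_ (ᘁH : V) H) ▷ (X ⊗ H) ≫ (𝟙_ V) ◁ r) ⊗≫ 𝟙 X := by
        rw [← braiding_inv_naturality_left, braiding_inv_tensorUnit_right]; monoidal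
    _ = 𝟙 X ⊗≫ X ◁ η_ (ᘁH : V) H ⊗≫ (β_ X (ᘁH : V)).hom ▷ H ⊗≫
        (ᘁH : V) ◁ (K.leftDualCoact (X ⊗ H) ≫ K.C ◁ r) ⊗≫
        ((β_ (ᘁH : V) K.C).hom ≫ τ ▷ (ᘁH : V) ≫ ε_ (ᘁH : V) H) ▷ X ⊗≫ 𝟙 X := by
        rw [← whisker_exchange]; monoidal
    -- Here `leftDualCoact` is moved past the action r, from X ⊗ H to X.
    _ = 𝟙 X ⊗≫ X ◁ η_ (ᘁH : V) H ⊗≫ (β_ X (ᘁH : V)).hom ▷ H ⊗≫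
        (ᘁH : V) ◁ (r ▷ (𝟙_ V) ≫ X ◁ (η_ (ᘁX : V) X ≫ K.coact (ᘁX : V) ▷ X)) ⊗≫
        (ᘁH : V) ◁ ε_ (ᘁX : V) X ▷ (K.C ⊗ X) ⊗≫
        ((β_ (ᘁH : V) K.C).hom ≫ τ ▷ (ᘁH : V) ≫ ε_ (ᘁH : V) H) ▷ X ⊗≫ 𝟙 X := by
        rw [← K.leftDualCoact_naturality, CoendData.leftDualCoact]; monoidal
    _ = 𝟙 X ⊗≫ ((X ◁ η_ (ᘁH : V) H ⊗≫ (β_ X (ᘁH : V)).hom ▷ H ⊗≫ 𝟙 ((ᘁH : V) ⊗ (X ⊗ H))) ▷ (𝟙_ V) ≫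
        ((ᘁH : V) ⊗ (X ⊗ H)) ◁ (η_ (ᘁX : V) X ≫ K.coact (ᘁX : V) ▷ X)) ⊗≫
        (ᘁH : V) ◁ ((r ▷ (ᘁX : V) ≫ ε_ (ᘁX : V) X)) ▷ (K.C ⊗ X) ⊗≫
        ((β_ (ᘁH : V) K.C).hom ≫ τ ▷ (ᘁH : V) ≫ ε_ (ᘁH : V) H) ▷ X ⊗≫ 𝟙 X := by
        rw [← whisker_exchange]; monoidal
    _ = _ := by
        rw [← whisker_exchange]; monoidal

/-- The left side is the dual morphism of the action of t on the dual module. Evaluating that action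
moves it onto M through the antipode of H, which is the formula already obtained for S(t). -/
lemma elementAct_dual (t : K.C ⟶ H) (M : RMod H) :
    (ρ_ M.X).inv ≫ M.X ◁ η_ (ᘁM.X : V) M.X ≫
      M.X ◁ (K.coact (ᘁM.X : V) ≫ (ᘁM.X : V) ◁ t ≫ dAct (M.X ◁ 𝒮[H] ≫ M.act)) ▷ M.X ≫
      (α_ M.X (ᘁM.X : V) M.X).inv ≫ ε_ (ᘁM.X : V) M.X ▷ M.X ≫ (λ_ M.X).hom =
      elementAct (elementAntipode t) M := by
  rw [elementAct_elementAntipode]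
  obtain ⟨X, r, hr₁, hr⟩ := M
  have d := dAct_ev (D := (ᘁX : V)) (X ◁ 𝒮[H] ≫ r)
  dsimp only
  calc _ = 𝟙 X ⊗≫ X ◁ η_ (ᘁX : V) X ⊗≫ X ◁ K.coact (ᘁX : V) ▷ X ⊗≫ X ◁ (ᘁX : V) ◁ t ▷ X ⊗≫
        (X ◁ dAct (X ◁ 𝒮[H] ≫ r) ≫ ε_ (ᘁX : V) X) ▷ X ⊗≫ 𝟙 X := by monoidal
    _ = 𝟙 X ⊗≫ X ◁ η_ (ᘁX : V) X ⊗≫ X ◁ K.coact (ᘁX : V) ▷ X ⊗≫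
        (X ◁ ((ᘁX : V) ◁ t ≫ (β_ (ᘁX : V) H).hom) ⊗≫ X ◁ 𝒮[H] ▷ (ᘁX : V) ⊗≫
          (r ▷ (ᘁX : V) ≫ ε_ (ᘁX : V) X)) ▷ X ⊗≫ 𝟙 X := by
        rw [d, dPair]; monoidal
    _ = _ := by
        rw [braiding_naturality_right]; monoidal

lemma RMatrix.isRibbon_iff (R : RMatrix K H) (b : R.BalancedStructure) :
    b.IsRibbon ↔ R.IsRibbonElement (R.balancedEquiv b).1 := by
  have h (M : RMod H) : (rightAdjointMate (X := (ᘁM : RMod H)) (Y := (ᘁM : RMod H))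
      (b.θ.app (ᘁM : RMod H))).hom = elementAct (elementAntipode (elementOf K b.θ)) M := by
    refine Eq.trans ?_ (elementAct_dual (elementOf K b.θ) M)
    -- Evaluation and coevaluation of a dual module are those of V, so the mate is computed in V;
    -- only θ on the dual module has to be rewritten as an action.
    exact congrArg (fun g : (ᘁM.X : V) ⟶ (ᘁM.X : V) => (ρ_ M.X).inv ≫ M.X ◁ η_ (ᘁM.X : V) M.X ≫
      M.X ◁ g ▷ M.X ≫ (α_ M.X (ᘁM.X : V) M.X).inv ≫ ε_ (ᘁM.X : V) M.X ▷ M.X ≫ (λ_ M.X).hom)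
      (elementAct_elementOf (K := K) b.θ (dual M)).symm
  constructor
  · intro r
    refine ⟨(R.balancedEquiv b).2, elementAct_injective fun M => ?_⟩
    refine (h M).symm.trans ((congrArg RMod.Hom.hom (r M)).trans ?_)
    exact (elementAct_elementOf b.θ M).symm
  · intro r M
    apply RMod.Hom.ext
    refine (h M).trans ?_
    have e : elementAntipode (elementOf K b.θ) = elementOf K b.θ := r.antipode
    rw [e]
    exact elementAct_elementOf b.θ M

end RibbonElements

theorem mainTheorem2 {V : Type u} [Category.{v} V] [MonoidalCategory V] [BraidedCategory V]
    [RigidCategory V] (K : CoendData V) :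
    (∀ (H : V) [BimonObj H] (R : RMatrix K H),
      ∃ e : R.BalancedStructure ≃ {t : K.C ⟶ H // R.IsBalancedElement t},
        ∀ (b : R.BalancedStructure) (M : RMod H), (b.θ.app M).hom = elementAct (e b).1 M) ∧
    (∀ (H : V) [HopfObj H] [IsIso 𝒮[H]] (R : RMatrix K H),
      ∃ e : R.BalancedStructure ≃ {t : K.C ⟶ H // R.IsBalancedElement t},
        (∀ (b : R.BalancedStructure) (M : RMod H), (b.θ.app M).hom = elementAct (e b).1 M) ∧
        ∀ b : R.BalancedStructure, b.IsRibbon ↔ R.IsRibbonElement (e b).1) := by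
  refine ⟨fun H _ R => ⟨R.balancedEquiv, fun b M => (elementAct_elementOf b.θ M).symm⟩,
    fun H _ _ R => ⟨R.balancedEquiv, fun b M => (elementAct_elementOf b.θ M).symm,
      fun b => R.isRibbon_iff b⟩⟩
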